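/- **Theorem 1.** Let $n\ge 0$, $\delta=x\,\frac{d}{dx}$, and let $F(x,y_0,\dots,y_n)$ be holomorphic in a polydisc $\Delta=\{|x|<\rho,\ |y_j|<\varepsilon_j,\ j=0,\dots,n\}$, where $0<\rho<\infty$ and $0<\varepsilon_j\le\infty$. Let $\eta\in\mathbb R\setminus\{0\}$ and let $$\varphi=\sum_{k=0}^\infty \alpha_k(x^{\mathrm i\eta})\,x^k$$ be an exotic formal series, that is, all $\alpha_k(t)$ are holomorphic in one common punctured disc $\mathcal D=\{0<|t|<r\}$ and meromorphic at $t=0$. With $t=x^{\mathrm i\eta}$, the derivation $\delta$ acts on such series termwise by $\delta\bigl(\alpha(t)x^k\bigr)=\bigl(k\,\alpha(t)+\mathrm i\eta\,t\,\alpha'(t)\bigr)x^k$. Put $\Phi=(\varphi,\delta\varphi,\dots,\delta^n\varphi)$ and let $\Phi_0(t)$ be the tuple of the coefficients of $x^0$ in $\Phi$. Suppose that $(0,\Phi_0(t))\in\Delta$ for all sufficiently small $t\neq0$, so that $F(x,\Phi)$ and $\frac{\partial F}{\partial y_i}(x,\Phi)$ are defined, by Taylor expansion in $x$, as formal power series in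 $x$ whose coefficients are functions of $t$ in a punctured neighbourhood of $0$. Suppose that $\varphi$ is a formal solution of the equation $F(x,y,\delta y,\dots,\delta^n y)=0$, that is, $F(x,\Phi)=0$. Suppose further that, for some integer $N\ge0$ and for all $i=0,\dots,n$, $$\frac{\partial F}{\partial y_i}(x,\Phi)=B_i(x^{\mathrm i\eta})\,x^N+D_i(x^{\mathrm i\eta})\,x^{N+1}+\dots,$$ with the same $N$ for all $i$, where the $B_i$ are meromorphic at $0$, $B_n\not\equiv0$ (in particular $\frac{\partial F}{\partial y_n}(x,\Phi)\not\equiv0$), and $$\operatorname{ord}_0B_i\ge\operatorname{ord}_0B_n,\qquad i=0,\dots,n$$ (with $\operatorname{ord}_0 0=+\infty$). Then there are an open sector $S\subset\mathbb C\setminus\mathbb R_+$ with vertex at the origin and of sufficiently small radius, where $\mathbb R_+=[0,\infty)$, and a branch of $\log x$ on $\mathbb C\setminus\mathbb R_+$ such that, with $x^{\mathrm i\eta}=e^{\mathrm i\eta\log x}$ for this branch, one has $x^{\mathrm i\eta}\in\mathcal D$ for all $x\in S$ and the series $\sum_{k\ge0}\alpha_k(x^{\mathrm i\eta})x^k$ converges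 uniformly on $S$. -/

import Mathlib

open Filter Topology
open scoped ENNReal

noncomputable section

namespace Exotic

/-- The polydisc `|x| < ρ`, `|y_j| < ε_j` for `j = 0, …, n`; the radii `ε_j` may be infinite, so
that functions polynomial in the `y_j` can be regarded on the whole `y`-space. -/
def polydisc {n : ℕ} (ρ : ℝ) (ε : Fin (n + 1) → ℝ≥0∞) : Set (ℂ × (Fin (n + 1) → ℂ)) :=
  {p | ‖p.1‖ < ρ ∧ ∀ j, ‖p.2 j‖ₑ < ε j}

/-- The punctured disc `0 < |t| < r`. -/
def puncturedDisc (r : ℝ) : Set ℂ :=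
  {t | 0 < ‖t‖ ∧ ‖t‖ < r}

/-- A sequence `α` stands for the formal series `∑ k, α k (x ^ (i η)) x ^ k`. It is exotic if the
`α k` are meromorphic at the origin and holomorphic in the common punctured disc `0 < |t| < r`. -/
def IsExoticSeries (r : ℝ) (α : ℕ → ℂ → ℂ) : Prop :=
  ∀ k, MeromorphicAt (α k) 0 ∧ DifferentiableOn ℂ (α k) (puncturedDisc r)

/-- The derivation `δ = x d/dx` on formal series: with `t = x ^ (i η)`,
`δ (a(t) x ^ k) = (k a(t) + i η t a'(t)) x ^ k`. -/
def delta (η : ℝ) (α : ℕ → ℂ → ℂ) : ℕ → ℂ → ℂ :=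
  fun k t => (k : ℂ) * α k t + Complex.I * (η : ℂ) * t * deriv (α k) t

/-- The tuple `Φ = (φ, δ φ, …, δ ^ n φ)`. -/
def jet (n : ℕ) (η : ℝ) (α : ℕ → ℂ → ℂ) : Fin (n + 1) → ℕ → ℂ → ℂ :=
  fun i => (delta η)^[(i : ℕ)] α

/-- The coefficient (a function of `t`) of `x ^ k` in the formal series `G(x, Y)`, where
`Y i = ∑ j, Y i j t * x ^ j`. As it depends only on the terms of `Y` of degree at most `k` in `x`,
it is the `k`-th Taylor coefficient at `x = 0` of the function obtained by substituting the
truncations of the `Y i`. It is meaningful when `G` is holomorphic at `(0, Y · 0 t)`. -/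
def substCoeff {n : ℕ} (G : ℂ × (Fin (n + 1) → ℂ) → ℂ) (Y : Fin (n + 1) → ℕ → ℂ → ℂ)
    (k : ℕ) (t : ℂ) : ℂ :=
  iteratedDeriv k
    (fun x : ℂ => G (x, fun i => ∑ j ∈ Finset.range (k + 1), Y i j t * x ^ j)) 0 / (k.factorial : ℂ)

/-- The partial derivative `∂F/∂y_i`. -/
def partialY {n : ℕ} (F : ℂ × (Fin (n + 1) → ℂ) → ℂ) (i : Fin (n + 1)) :
    ℂ × (Fin (n + 1) → ℂ) → ℂ :=
  fun p => fderiv ℂ F p (0, Pi.single i 1)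

/-- `φ` is a formal solution of `F(x, y, δ y, …, δ ^ n y) = 0`, with `F` given on `Δ`: near `t = 0`
the leading terms of `(x, Φ)` lie in `Δ`, so that `F(x, Φ)` makes sense, and all the coefficients
of `F(x, Φ)` vanish. -/
def IsFormalSolution {n : ℕ} (Δ : Set (ℂ × (Fin (n + 1) → ℂ))) (F : ℂ × (Fin (n + 1) → ℂ) → ℂ)
    (η : ℝ) (α : ℕ → ℂ → ℂ) : Prop :=
  ∀ᶠ t in 𝓝[≠] (0 : ℂ),
    ((0 : ℂ), fun i => jet n η α i 0 t) ∈ Δ ∧ ∀ k, substCoeff F (jet n η α) k t = 0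

/-- The open sector `0 < |x| < R`, `θ₁ < arg x < θ₂` with vertex at the origin. -/
def openSector (R θ₁ θ₂ : ℝ) : Set ℂ :=
  {x | ∃ r θ : ℝ, 0 < r ∧ r < R ∧ θ₁ < θ ∧ θ < θ₂ ∧ x = (r : ℂ) * Complex.exp ((θ : ℂ) * Complex.I)}

/-- The ray `ℝ_+ = [0, ∞)` in the complex plane. -/
def nonnegRay : Set ℂ :=
  {x | 0 ≤ x.re ∧ x.im = 0}

/-- The branch of the logarithm on `ℂ ∖ ℝ_+` whose imaginary part lies in `(2πm, 2π(m+1))`;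
each branch of the logarithm on `ℂ ∖ ℝ_+` is one of these. -/
def branchLog (m : ℤ) (x : ℂ) : ℂ :=
  Complex.log (-x) + (2 * (m : ℂ) + 1) * (Real.pi : ℂ) * Complex.I

/-- The corresponding branch of `x ^ (i η)` on `ℂ ∖ ℝ_+`. -/
def branchPow (m : ℤ) (η : ℝ) (x : ℂ) : ℂ :=
  Complex.exp (Complex.I * (η : ℂ) * branchLog m x)

end Exotic

end

/-!
On a compact rotation-invariant annulus `A` in the `t`-plane on which the leading coefficient
`B_n` has no zero, substitute `Φ = Φ_{≤ M} + x ^ M y` into `F(x, Φ) = 0`, divide by `x ^ (M + N)`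
and solve for the last entry: this gives `y_n = Ψ(x, t, y)`. The lower entries are recovered from
`y_n` by inverting `δ + M`, which is integration along the flow `(x, t) ↦ (e^{-u} x, e^{-iηu} t)`.
As `η` is real, the flow rotates `t` and so preserves `A`, and each inversion gains a factor
`1 / M`; hence for large `M` the equation is a contraction on the functions bounded by `1` on
`0 < |x| < s`, `t ∈ A`. Truncations of the formal solution solve it up to any order in `x`, so the
fixed point has them as its Taylor polynomials, and the Cauchy estimates give `|α_k(t)| ≤ C K ^ k`
uniformly on `A`. This suffices, because a suitable branch of `x ^ (iη)` maps a whole sector into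
`A`.
-/

noncomputable section

namespace Exotic

open Asymptotics MeasureTheory Metric Set

section DominatedIntegral

variable {Ω E : Type*} [MeasurableSpace Ω] {μ : Measure Ω} [NormedAddCommGroup E]

theorem aestronglyMeasurable_of_ae_hasDerivAt {𝕜 : Type*} [NontriviallyNormedField 𝕜]
    [NormedSpace 𝕜 E] {f : 𝕜 → Ω → E} {f' : Ω → E} {x : 𝕜}
    (hf : ∀ᶠ y in 𝓝 x, AEStronglyMeasurable (f y) μ)
    (hd : ∀ᵐ u ∂μ, HasDerivAt (fun y => f y u) (f' u) x) : AEStronglyMeasurable f' μ := by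
  obtain ⟨y, hy, hfy⟩ := exists_seq_forall_of_frequently (l := 𝓝[≠] x)
    (hf.filter_mono nhdsWithin_le_nhds).frequently
  refine aestronglyMeasurable_of_tendsto_ae atTop
    (f := fun k u => slope (fun y => f y u) x (y k)) (fun k => ?_)
    (hd.mono fun u hu => hu.tendsto_slope.comp hy)
  simp only [slope_def_module]
  exact ((hfy k).sub hf.self_of_nhds).const_smul (y k - x)⁻¹

/-- A holomorphic family needs no bound on its derivative: a dominating function for the family
itself bounds the derivative on a smaller disc by the Cauchy estimate. -/
theorem differentiableAt_integral_of_dominated [NormedSpace ℂ E] {f : ℂ → Ω → E} {x : ℂ} {ε : ℝ}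
    (hε : 0 < ε) {bound : Ω → ℝ} (hbound : Integrable bound μ)
    (hmeas : ∀ y ∈ ball x ε, AEStronglyMeasurable (f y) μ)
    (hd : ∀ᵐ u ∂μ, DifferentiableOn ℂ (fun y => f y u) (ball x ε))
    (hb : ∀ᵐ u ∂μ, ∀ y ∈ ball x ε, ‖f y u‖ ≤ bound u) :
    DifferentiableAt ℂ (fun y => ∫ u, f y u ∂μ) x := by
  have hx : x ∈ ball x ε := mem_ball_self hε
  have hmeas' : ∀ᶠ y in 𝓝 x, AEStronglyMeasurable (f y) μ := by
    filter_upwards [ball_mem_nhds x hε] with y hy using hmeas y hy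
  have hderiv : ∀ᵐ u ∂μ, ∀ y ∈ ball x ε,
      HasDerivAt (fun y => f y u) (deriv (fun y => f y u) y) y :=
    hd.mono fun u hu y hy => (hu.differentiableAt (isOpen_ball.mem_nhds hy)).hasDerivAt
  refine (hasDerivAt_integral_of_dominated_loc_of_deriv_le (s := ball x (ε / 2))
    (F' := fun y u => deriv (fun y => f y u) y) (bound := fun u => bound u / (ε / 4))
    (ball_mem_nhds x (half_pos hε)) hmeas' (hbound.mono' (hmeas x hx) (hb.mono fun u hu => hu x hx))
    (aestronglyMeasurable_of_ae_hasDerivAt hmeas' (hderiv.mono fun u hu => hu x hx)) ?_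
    (hbound.div_const _) ?_).2.differentiableAt
  · filter_upwards [hd, hb] with u hu hbu y hy
    have hsub : closedBall y (ε / 4) ⊆ ball x ε := by
      refine closedBall_subset_ball' ?_
      linarith [mem_ball.1 hy]
    exact Complex.norm_deriv_le_of_forall_mem_sphere_norm_le (by linarith)
      ((hu.mono hsub).diffContOnCl_ball subset_rfl)
      fun z hz => hbu z (hsub (sphere_subset_closedBall hz))
  · filter_upwards [hderiv] with u hu y hy
    exact hu y (ball_subset_ball (by linarith) hy)

end DominatedIntegral

theorem isOpen_puncturedDisc (r : ℝ) : IsOpen (puncturedDisc r) :=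
  (isOpen_lt continuous_const continuous_norm).inter (isOpen_lt continuous_norm continuous_const)

theorem puncturedDisc_mono {r r' : ℝ} (h : r ≤ r') : puncturedDisc r ⊆ puncturedDisc r' :=
  fun _ ht => ⟨ht.1, ht.2.trans_le h⟩

theorem ball_sdiff_eq_puncturedDisc (r : ℝ) : ball (0 : ℂ) r \ {0} = puncturedDisc r := by
  ext x
  simp [puncturedDisc, and_comm]

theorem exp_neg_mul_mem_puncturedDisc {ρ u : ℝ} {x : ℂ} (hu : 0 ≤ u) (hx : x ∈ puncturedDisc ρ) :
    Complex.exp (-u) * x ∈ puncturedDisc ρ := by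
  have hnorm : ‖Complex.exp (-(u : ℂ)) * x‖ = Real.exp (-u) * ‖x‖ := by
    simp [Complex.norm_exp]
  refine ⟨hnorm ▸ mul_pos (Real.exp_pos _) hx.1, hnorm ▸ lt_of_le_of_lt ?_ hx.2⟩
  exact mul_le_of_le_one_left (norm_nonneg _) (Real.exp_le_one_iff.2 (neg_nonpos.2 hu))

/-- Invariance of a set under rotations about the origin. -/
def RotInvariant (A : Set ℂ) : Prop := ∀ t ∈ A, ∀ z : ℂ, ‖z‖ = 1 → z * t ∈ A

theorem RotInvariant.exp_mul_mem {A : Set ℂ} (hA : RotInvariant A) {t : ℂ} (ht : t ∈ A)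
    (η u : ℝ) : Complex.exp (-(Complex.I * η * u)) * t ∈ A := by
  refine hA t ht _ ?_
  rw [Complex.norm_exp]
  simp

/-- The functions of `(x, t)`, `0 < |x| < ρ`, `t ∈ A`, on which the contraction acts: jointly
continuous, holomorphic in `x` and bounded by `C`. The point `x = 0` is left out because only
the punctured disc is needed along the flow, and it is a removable singularity anyway. -/
structure Admissible (A : Set ℂ) (ρ C : ℝ) (v : ℂ → ℂ → ℂ) : Prop where
  cont : ContinuousOn (fun p : ℂ × ℂ => v p.1 p.2) (puncturedDisc ρ ×ˢ A)
  diff : ∀ t ∈ A, DifferentiableOn ℂ (fun x => v x t) (puncturedDisc ρ)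
  bound : ∀ x ∈ puncturedDisc ρ, ∀ t ∈ A, ‖v x t‖ ≤ C

/-- The function `v` transported to time `-u` by the flow of `δ`, which is
`(x, t) ↦ (e^u x, e^{iηu} t)`, and damped by `e^{-κu}`. -/
def dampedFlow (κ η : ℝ) (v : ℂ → ℂ → ℂ) (u : ℝ) (x t : ℂ) : ℂ :=
  Complex.exp (-κ * u) * v (Complex.exp (-u) * x) (Complex.exp (-(Complex.I * η * u)) * t)

/-- The inverse of `κ + δ`, where `δ = x ∂/∂x + iη t ∂/∂t`, on bounded functions: integration
along the flow of `δ`. -/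
def flowInt (κ η : ℝ) (v : ℂ → ℂ → ℂ) (x t : ℂ) : ℂ :=
  ∫ u in Ioi (0 : ℝ), dampedFlow κ η v u x t

section Flow

variable {A : Set ℂ} {ρ C C' E κ η u : ℝ} {v w : ℂ → ℂ → ℂ} {x t : ℂ}

theorem admissible_zero (hC : 0 ≤ C) : Admissible A ρ C (fun _ _ => 0) :=
  ⟨continuousOn_const, fun _ _ => differentiableOn_const _, fun _ _ _ _ => by simpa⟩

namespace Admissible

theorem mono_radius {ρ' : ℝ} (hv : Admissible A ρ C v) (h : ρ' ≤ ρ) : Admissible A ρ' C v := by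
  have hs := puncturedDisc_mono h
  exact ⟨hv.cont.mono (prod_mono hs subset_rfl), fun t ht => (hv.diff t ht).mono hs,
    fun x hx => hv.bound x (hs hx)⟩

theorem of_bound (hv : Admissible A ρ C v) (h : ∀ x ∈ puncturedDisc ρ, ∀ t ∈ A, ‖v x t‖ ≤ C') :
    Admissible A ρ C' v :=
  ⟨hv.cont, hv.diff, h⟩

theorem sub (hv : Admissible A ρ C v) (hw : Admissible A ρ C' w) :
    Admissible A ρ (C + C') (fun x t => v x t - w x t) :=
  ⟨hv.cont.sub hw.cont, fun t ht => (hv.diff t ht).sub (hw.diff t ht),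
    fun x hx t ht => norm_sub_le_of_le (hv.bound x hx t ht) (hw.bound x hx t ht)⟩

theorem dampedFlow (hA : RotInvariant A) (hv : Admissible A ρ C v) (hu : 0 ≤ u) :
    Admissible A ρ (C * Real.exp (-κ * u)) (dampedFlow κ η v u) where
  cont := ContinuousOn.mul continuousOn_const <| hv.cont.comp (by fun_prop) fun q hq =>
    mk_mem_prod (exp_neg_mul_mem_puncturedDisc hu hq.1) (hA.exp_mul_mem hq.2 η u)
  diff t ht := ((hv.diff _ (hA.exp_mul_mem ht η u)).comp (by fun_prop)
    fun _ hy => exp_neg_mul_mem_puncturedDisc hu hy).const_mul _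
  bound x hx t ht := by
    have hexp : ‖Complex.exp (-κ * u)‖ = Real.exp (-κ * u) := by simp [Complex.norm_exp]
    rw [Exotic.dampedFlow, norm_mul, hexp, mul_comm]
    exact mul_le_mul_of_nonneg_right (hv.bound _ (exp_neg_mul_mem_puncturedDisc hu hx) _
      (hA.exp_mul_mem ht η u)) (Real.exp_pos _).le

theorem continuousOn_dampedFlow (hA : RotInvariant A) (hv : Admissible A ρ C v)
    (hx : x ∈ puncturedDisc ρ) (ht : t ∈ A) :
    ContinuousOn (fun u => Exotic.dampedFlow κ η v u x t) (Ioi 0) := by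
  refine ContinuousOn.mul (by fun_prop) (hv.cont.comp (f := fun u : ℝ =>
    (Complex.exp (-u) * x, Complex.exp (-(Complex.I * η * u)) * t)) (by fun_prop) fun u hu => ?_)
  exact ⟨exp_neg_mul_mem_puncturedDisc (le_of_lt hu) hx, hA.exp_mul_mem ht η u⟩

theorem aestronglyMeasurable_dampedFlow (hA : RotInvariant A) (hv : Admissible A ρ C v)
    (hx : x ∈ puncturedDisc ρ) (ht : t ∈ A) :
    AEStronglyMeasurable (fun u => Exotic.dampedFlow κ η v u x t) (volume.restrict (Ioi 0)) :=
  (hv.continuousOn_dampedFlow hA hx ht).aestronglyMeasurable measurableSet_Ioi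

theorem integrableOn_dampedFlow (hA : RotInvariant A) (hκ : 0 < κ) (hv : Admissible A ρ C v)
    (hx : x ∈ puncturedDisc ρ) (ht : t ∈ A) :
    IntegrableOn (fun u => Exotic.dampedFlow κ η v u x t) (Ioi 0) := by
  refine ((exp_neg_integrableOn_Ioi 0 hκ).const_mul C).mono'
    (hv.aestronglyMeasurable_dampedFlow hA hx ht) ?_
  filter_upwards [ae_restrict_mem measurableSet_Ioi] with u hu
  exact (hv.dampedFlow hA (le_of_lt hu)).bound x hx t ht

theorem norm_flowInt_le (hA : RotInvariant A) (hκ : 0 < κ) (hv : Admissible A ρ C v)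
    (hx : x ∈ puncturedDisc ρ) (ht : t ∈ A) : ‖flowInt κ η v x t‖ ≤ C / κ := by
  have hint : ∫ u in Ioi (0 : ℝ), C * Real.exp (-κ * u) = C / κ := by
    rw [integral_const_mul, integral_exp_mul_Ioi (neg_neg_of_pos hκ)]
    simp [div_eq_mul_inv]
  rw [← hint]
  refine norm_integral_le_of_norm_le ((exp_neg_integrableOn_Ioi 0 hκ).const_mul C) ?_
  filter_upwards [ae_restrict_mem measurableSet_Ioi] with u hu
  exact (hv.dampedFlow hA (le_of_lt hu)).bound x hx t ht

theorem flowInt (hA : RotInvariant A) (hκ : 0 < κ) (hv : Admissible A ρ C v) :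
    Admissible A ρ (C / κ) (flowInt κ η v) where
  cont := by
    intro p hp
    refine tendsto_integral_filter_of_dominated_convergence (fun u => C * Real.exp (-κ * u)) ?_ ?_
      ((exp_neg_integrableOn_Ioi 0 hκ).const_mul C) ?_
    · filter_upwards [self_mem_nhdsWithin] with q hq
      exact hv.aestronglyMeasurable_dampedFlow hA hq.1 hq.2
    · filter_upwards [self_mem_nhdsWithin] with q hq
      filter_upwards [ae_restrict_mem measurableSet_Ioi] with u hu
      exact (hv.dampedFlow hA (le_of_lt hu)).bound _ hq.1 _ hq.2
    · filter_upwards [ae_restrict_mem measurableSet_Ioi] with u hu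
      exact (hv.dampedFlow hA (le_of_lt hu)).cont p hp
  diff := by
    intro t ht x hx
    obtain ⟨ε, hε, hball⟩ := Metric.isOpen_iff.1 (isOpen_puncturedDisc ρ) x hx
    refine (differentiableAt_integral_of_dominated hε
      ((exp_neg_integrableOn_Ioi 0 hκ).const_mul C)
      (fun y hy => hv.aestronglyMeasurable_dampedFlow hA (hball hy) ht) ?_
      ?_).differentiableWithinAt
    · filter_upwards [ae_restrict_mem measurableSet_Ioi] with u hu
      exact ((hv.dampedFlow hA (le_of_lt hu)).diff t ht).mono hball
    · filter_upwards [ae_restrict_mem measurableSet_Ioi] with u hu y hy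
      exact (hv.dampedFlow hA (le_of_lt hu)).bound y (hball hy) t ht
  bound x hx t ht := hv.norm_flowInt_le hA hκ hx ht

theorem norm_flowInt_sub_le (hA : RotInvariant A) (hκ : 0 < κ) (hv : Admissible A ρ C v)
    (hw : Admissible A ρ C' w) (hE : ∀ x ∈ puncturedDisc ρ, ∀ t ∈ A, ‖v x t - w x t‖ ≤ E)
    (hx : x ∈ puncturedDisc ρ) (ht : t ∈ A) :
    ‖Exotic.flowInt κ η v x t - Exotic.flowInt κ η w x t‖ ≤ E / κ := by
  have hsub : Exotic.flowInt κ η v x t - Exotic.flowInt κ η w x t =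
      Exotic.flowInt κ η (fun x t => v x t - w x t) x t := by
    simp only [Exotic.flowInt]
    rw [← integral_sub (hv.integrableOn_dampedFlow hA hκ hx ht)
      (hw.integrableOn_dampedFlow hA hκ hx ht)]
    simp only [Exotic.dampedFlow, mul_sub]
  rw [hsub]
  exact ((hv.sub hw).of_bound hE).norm_flowInt_le hA hκ hx ht

theorem iterate_flowInt (hA : RotInvariant A) (hκ : 1 ≤ κ) (hC : 0 ≤ C) (hv : Admissible A ρ C v)
    (k : ℕ) : Admissible A ρ C ((Exotic.flowInt κ η)^[k] v) := by
  induction k with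
  | zero => exact hv
  | succ k ih =>
    have hstep := ih.flowInt (η := η) hA (zero_lt_one.trans_le hκ)
    rw [Function.iterate_succ_apply']
    exact hstep.of_bound fun x hx t ht => (hstep.bound x hx t ht).trans (div_le_self hC hκ)

theorem norm_iterate_flowInt_sub_le (hA : RotInvariant A) (hκ : 1 ≤ κ) (hC : 0 ≤ C) (hC' : 0 ≤ C')
    (hv : Admissible A ρ C v) (hw : Admissible A ρ C' w) (hE₀ : 0 ≤ E)
    (hE : ∀ x ∈ puncturedDisc ρ, ∀ t ∈ A, ‖v x t - w x t‖ ≤ E) (k : ℕ) :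
    ∀ x ∈ puncturedDisc ρ, ∀ t ∈ A,
      ‖(Exotic.flowInt κ η)^[k] v x t - (Exotic.flowInt κ η)^[k] w x t‖ ≤ E := by
  induction k with
  | zero => exact hE
  | succ k ih =>
    intro x hx t ht
    rw [Function.iterate_succ_apply', Function.iterate_succ_apply']
    exact ((hv.iterate_flowInt hA hκ hC k).norm_flowInt_sub_le hA (zero_lt_one.trans_le hκ)
      (hw.iterate_flowInt hA hκ hC' k) ih hx ht).trans (div_le_self hE₀ hκ)

theorem tendsto_dampedFlow_atTop (hA : RotInvariant A) (hκ : 0 < κ) (hv : Admissible A ρ C v)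
    (hx : x ∈ puncturedDisc ρ) (ht : t ∈ A) :
    Tendsto (fun u => Exotic.dampedFlow κ η v u x t) atTop (𝓝 0) := by
  have hexp : Tendsto (fun u => C * Real.exp (-κ * u)) atTop (𝓝 0) := by
    simpa using (Real.tendsto_exp_atBot.comp
      (tendsto_id.const_mul_atTop_of_neg (neg_neg_of_pos hκ))).const_mul C
  refine squeeze_zero_norm' ?_ hexp
  filter_upwards [eventually_ge_atTop 0] with u hu using (hv.dampedFlow hA hu).bound x hx t ht

theorem flowInt_eq_of_hasDerivAt (hA : RotInvariant A) (hκ : 0 < κ) (hv : Admissible A ρ C v)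
    (hw : Admissible A ρ C' w) (hx : x ∈ puncturedDisc ρ) (ht : t ∈ A)
    (hd : ∀ u : ℝ, HasDerivAt (fun u => Exotic.dampedFlow κ η w u x t)
      (-Exotic.dampedFlow κ η v u x t) u) :
    Exotic.flowInt κ η v x t = w x t := by
  have hftc := integral_Ioi_of_hasDerivAt_of_tendsto' (a := 0) (fun u _ => (hd u).fun_neg)
    (by simpa using hv.integrableOn_dampedFlow hA hκ hx ht)
    (hw.tendsto_dampedFlow_atTop hA hκ hx ht).neg
  simpa [Exotic.flowInt, Exotic.dampedFlow] using hftc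

end Admissible

theorem flowInt_congr (hA : RotInvariant A)
    (h : ∀ x ∈ puncturedDisc ρ, ∀ t ∈ A, v x t = w x t) (hx : x ∈ puncturedDisc ρ) (ht : t ∈ A) :
    flowInt κ η v x t = flowInt κ η w x t := by
  refine setIntegral_congr_fun measurableSet_Ioi fun u hu => ?_
  simp only [dampedFlow]
  rw [h _ (exp_neg_mul_mem_puncturedDisc (le_of_lt hu) hx) _ (hA.exp_mul_mem ht η u)]

end Flow

theorem norm_iteratedDeriv_zero_le {f : ℂ → ℂ} {ρ E : ℝ} (hρ : 0 < ρ)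
    (hf : DifferentiableOn ℂ f (ball 0 ρ)) (hE : ∀ x ∈ puncturedDisc ρ, ‖f x‖ ≤ E) (k : ℕ) :
    ‖iteratedDeriv k f 0‖ ≤ k.factorial * (E * (2 / ρ) ^ k) := by
  refine (Complex.norm_iteratedDeriv_le_of_forall_mem_sphere_norm_le (C := E) k (half_pos hρ)
    (hf.diffContOnCl_ball (closedBall_subset_ball (by linarith))) ?_).trans_eq ?_
  · intro x hx
    have hnorm : ‖x‖ = ρ / 2 := by simpa using hx
    exact hE x ⟨by linarith, by linarith⟩
  · rw [div_pow, div_pow]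
    field_simp

theorem exists_differentiableOn_ball_eqOn_puncturedDisc {g : ℂ → ℂ} {s B : ℝ} (hs : 0 < s)
    (hg : DifferentiableOn ℂ g (puncturedDisc s)) (hB : ∀ x ∈ puncturedDisc s, ‖g x‖ ≤ B) :
    ∃ G : ℂ → ℂ, DifferentiableOn ℂ G (ball 0 s) ∧ EqOn G g (puncturedDisc s) := by
  rw [← ball_sdiff_eq_puncturedDisc] at hg hB ⊢
  refine ⟨Function.update g 0 (limUnder (𝓝[≠] 0) g),
    Complex.differentiableOn_update_limUnder_of_bddAbove (ball_mem_nhds 0 hs) hg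
      ⟨B, forall_mem_image.2 hB⟩, fun x hx => Function.update_of_ne hx.2 _ _⟩

theorem norm_iteratedDeriv_zero_le_of_norm_sub_le {g P : ℂ → ℂ} {s ρ B E : ℝ} (hρ : 0 < ρ)
    (hρs : ρ ≤ s) (hg : DifferentiableOn ℂ g (puncturedDisc s))
    (hB : ∀ x ∈ puncturedDisc s, ‖g x‖ ≤ B) (hP : DifferentiableOn ℂ P (ball 0 ρ))
    (hE : ∀ x ∈ puncturedDisc ρ, ‖g x - P x‖ ≤ E) (k : ℕ) :
    ‖iteratedDeriv k P 0‖ ≤ k.factorial * (B * (2 / s) ^ k + E * (2 / ρ) ^ k) := by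
  have hs := hρ.trans_le hρs
  obtain ⟨G, hG, hGg⟩ := exists_differentiableOn_ball_eqOn_puncturedDisc hs hg hB
  have hGP := hG.mono (ball_subset_ball hρs) |>.sub hP
  have hderivG := norm_iteratedDeriv_zero_le hs hG (fun x hx => hGg hx ▸ hB x hx) k
  have hderivGP := norm_iteratedDeriv_zero_le hρ hGP
    (fun x hx => by simpa [hGg (puncturedDisc_mono hρs hx)] using hE x hx) k
  rw [iteratedDeriv_sub (hG.analyticAt (ball_mem_nhds 0 hs)).contDiffAt
    (hP.analyticAt (ball_mem_nhds 0 hρ)).contDiffAt] at hderivGP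
  rw [mul_add]
  calc ‖iteratedDeriv k P 0‖
      = ‖iteratedDeriv k G 0 - (iteratedDeriv k G 0 - iteratedDeriv k P 0)‖ := by
        rw [sub_sub_cancel]
    _ ≤ _ := norm_sub_le_of_le hderivG hderivGP

/-- First `m → ∞`, then `ρ → 0`: the error `C ρ^{k+1}` beats the factor `ρ^{-k}` which the Cauchy
estimate on the disc of radius `ρ` costs. -/
theorem norm_iteratedDeriv_zero_le_of_tendsto {g : ℕ → ℂ → ℂ} {P : ℂ → ℂ} {e : ℕ → ℝ}
    {s ρ₀ B C : ℝ} {k : ℕ} (hρ₀ : 0 < ρ₀) (hρ₀s : ρ₀ ≤ s) (he : Tendsto e atTop (𝓝 0))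
    (hg : ∀ m, DifferentiableOn ℂ (g m) (puncturedDisc s))
    (hB : ∀ m, ∀ x ∈ puncturedDisc s, ‖g m x‖ ≤ B) (hP : DifferentiableOn ℂ P (ball 0 ρ₀))
    (hgP : ∀ ρ ∈ Ioc 0 ρ₀, ∀ m, ∀ x ∈ puncturedDisc ρ, ‖g m x - P x‖ ≤ e m + C * ρ ^ (k + 1)) :
    ‖iteratedDeriv k P 0‖ ≤ k.factorial * (B * (2 / s) ^ k) := by
  have hradius : ∀ ρ ∈ Ioc 0 ρ₀,
      ‖iteratedDeriv k P 0‖ ≤ k.factorial * (B * (2 / s) ^ k + C * 2 ^ k * ρ) := by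
    intro ρ hρ
    have hlim : Tendsto (fun m => k.factorial * (B * (2 / s) ^ k +
        (e m + C * ρ ^ (k + 1)) * (2 / ρ) ^ k)) atTop
        (𝓝 (k.factorial * (B * (2 / s) ^ k + (0 + C * ρ ^ (k + 1)) * (2 / ρ) ^ k))) :=
      (((he.add_const _).mul_const _).const_add _).const_mul _
    refine (ge_of_tendsto' hlim fun m => norm_iteratedDeriv_zero_le_of_norm_sub_le hρ.1
      (hρ.2.trans hρ₀s) (hg m) (hB m) (hP.mono (ball_subset_ball hρ.2))
      (hgP ρ hρ m) k).trans_eq ?_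
    have hρne : ρ ≠ 0 := hρ.1.ne'
    rw [div_pow 2 ρ]
    field_simp
    ring
  have hcont : Continuous fun ρ : ℝ => (k.factorial : ℝ) * (B * (2 / s) ^ k + C * 2 ^ k * ρ) := by
    fun_prop
  have hlim := (hcont.tendsto 0).mono_left (nhdsWithin_le_nhds (s := Ioi 0))
  rw [mul_zero, add_zero] at hlim
  refine ge_of_tendsto hlim ?_
  filter_upwards [Ioc_mem_nhdsGT hρ₀] with ρ hρ using hradius ρ hρ

theorem iteratedDeriv_sum_pow_zero (c : ℕ → ℂ) {L k : ℕ} (hk : k < L) :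
    iteratedDeriv (k + 1) (fun x : ℂ => ∑ j ∈ Finset.range L, c j * x ^ (j + 1)) 0 =
      (k + 1).factorial * c k := by
  rw [iteratedDeriv_fun_sum (fun i _ => by fun_prop), Finset.sum_eq_single k]
  · rw [iteratedDeriv_const_mul_field, iteratedDeriv_fun_pow_zero]
    simp [mul_comm]
  · intro j _ hj
    rw [iteratedDeriv_const_mul_field, iteratedDeriv_fun_pow_zero]
    simp [hj.symm]
  · simp [hk]

/-- The tuple `(y, δy, …, δⁿy)`, up to a shift `κ` of `δ`, recovered from its last entry `v` by
inverting `κ + δ` repeatedly. -/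
def flowJet (n : ℕ) (κ η : ℝ) (v : ℂ → ℂ → ℂ) (x t : ℂ) : Fin (n + 1) → ℂ :=
  fun i => (flowInt κ η)^[n - i] v x t

/-- Conditions under which `v ↦ Ψ(x, t, flowJet v)` maps the unit ball of the admissible functions
to itself and halves distances there: the entries of a flow jet other than the last one gain a
factor `1/κ`, so a Lipschitz bound in which they enter with the weight `κ` suffices. -/
structure IsContractive {n : ℕ} (κ : ℝ) (A : Set ℂ) (s : ℝ)
    (Ψ : ℂ → ℂ → (Fin (n + 1) → ℂ) → ℂ) : Prop where
  cont : ContinuousOn (fun q : ℂ × ℂ × (Fin (n + 1) → ℂ) => Ψ q.1 q.2.1 q.2.2)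
    (puncturedDisc s ×ˢ A ×ˢ closedBall 0 1)
  diff : ∀ t ∈ A, ∀ x ∈ puncturedDisc s, ∀ y ∈ closedBall (0 : Fin (n + 1) → ℂ) 1,
    DifferentiableAt ℂ (fun q : ℂ × (Fin (n + 1) → ℂ) => Ψ q.1 t q.2) (x, y)
  zero : ∀ x ∈ puncturedDisc s, ∀ t ∈ A, ‖Ψ x t 0‖ ≤ 1 / 2
  lip : ∀ x ∈ puncturedDisc s, ∀ t ∈ A, ∀ y ∈ closedBall (0 : Fin (n + 1) → ℂ) 1,
    ∀ y' ∈ closedBall (0 : Fin (n + 1) → ℂ) 1, ∀ E : ℝ,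
    (∀ i, ‖y i - y' i‖ ≤ E) → (∀ i, i ≠ Fin.last n → ‖y i - y' i‖ ≤ E / κ) →
    ‖Ψ x t y - Ψ x t y'‖ ≤ E / 2

/-- The iterates, starting from `0`, of the map `v ↦ Ψ(x, t, flowJet v)`. -/
def contractionIter {n : ℕ} (κ η : ℝ) (Ψ : ℂ → ℂ → (Fin (n + 1) → ℂ) → ℂ) : ℕ → ℂ → ℂ → ℂ
  | 0 => fun _ _ => 0
  | m + 1 => fun x t => Ψ x t (flowJet n κ η (contractionIter κ η Ψ m) x t)

section Contraction

variable {n : ℕ} {A : Set ℂ} {s ρ κ η E : ℝ} {Ψ : ℂ → ℂ → (Fin (n + 1) → ℂ) → ℂ}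
  {v w : ℂ → ℂ → ℂ} {x t : ℂ}

theorem flowInt_zero : flowInt κ η (fun _ _ => 0) = fun _ _ => 0 := by
  funext x t
  simp [flowInt, dampedFlow]

theorem flowJet_zero : flowJet n κ η (fun _ _ => 0) x t = 0 := by
  funext i
  have hfix : (flowInt κ η)^[n - i] (fun _ _ => 0) = fun _ _ => 0 :=
    Function.iterate_fixed flowInt_zero _
  simp [flowJet, hfix]

theorem Admissible.flowJet_mem_closedBall (hA : RotInvariant A) (hκ : 1 ≤ κ)
    (hv : Admissible A ρ 1 v) (hx : x ∈ puncturedDisc ρ) (ht : t ∈ A) :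
    flowJet n κ η v x t ∈ closedBall 0 1 := by
  rw [mem_closedBall_zero_iff, pi_norm_le_iff_of_nonneg zero_le_one]
  exact fun i => (hv.iterate_flowInt hA hκ zero_le_one (n - i)).bound x hx t ht

namespace IsContractive

theorem norm_sub_le (hΨ : IsContractive κ A s Ψ) (hA : RotInvariant A) (hκ : 1 ≤ κ) (hρ : ρ ≤ s)
    (hv : Admissible A ρ 1 v) (hw : Admissible A ρ 1 w) (hE₀ : 0 ≤ E)
    (hE : ∀ x ∈ puncturedDisc ρ, ∀ t ∈ A, ‖v x t - w x t‖ ≤ E)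
    (hx : x ∈ puncturedDisc ρ) (ht : t ∈ A) :
    ‖Ψ x t (flowJet n κ η v x t) - Ψ x t (flowJet n κ η w x t)‖ ≤ E / 2 := by
  have hiter := fun k =>
    hv.norm_iterate_flowInt_sub_le (η := η) hA hκ zero_le_one zero_le_one hw hE₀ hE k
  refine hΨ.lip x (puncturedDisc_mono hρ hx) t ht _ (hv.flowJet_mem_closedBall hA hκ hx ht) _
    (hw.flowJet_mem_closedBall hA hκ hx ht) E (fun i => hiter _ x hx t ht) (fun i hi => ?_)
  obtain ⟨k, hk⟩ : ∃ k, n - (i : ℕ) = k + 1 :=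
    Nat.exists_eq_succ_of_ne_zero (Nat.sub_ne_zero_of_lt (Fin.val_lt_last hi))
  simp only [flowJet, hk, Function.iterate_succ_apply']
  exact (hv.iterate_flowInt hA hκ zero_le_one k).norm_flowInt_sub_le hA (zero_lt_one.trans_le hκ)
    (hw.iterate_flowInt hA hκ zero_le_one k) (hiter k) hx ht

theorem admissible (hΨ : IsContractive κ A s Ψ) (hA : RotInvariant A) (hκ : 1 ≤ κ)
    (hv : Admissible A s 1 v) : Admissible A s 1 (fun x t => Ψ x t (flowJet n κ η v x t)) := by
  have hiter := fun k => hv.iterate_flowInt (η := η) hA hκ zero_le_one k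
  have hball := fun {x t} => hv.flowJet_mem_closedBall (n := n) (η := η) (x := x) (t := t) hA hκ
  refine ⟨?_, fun t ht x hx => ?_, fun x hx t ht => ?_⟩
  · exact hΨ.cont.comp (f := fun p : ℂ × ℂ => (p.1, p.2, flowJet n κ η v p.1 p.2))
      (continuousOn_fst.prodMk (continuousOn_snd.prodMk
        (continuousOn_pi.2 fun i => (hiter (n - i)).cont)))
      fun p hp => ⟨hp.1, hp.2, hball hp.1 hp.2⟩
  · have hjet : DifferentiableAt ℂ (fun x => flowJet n κ η v x t) x :=
      differentiableAt_pi.2 fun i => ((hiter (n - i)).diff t ht).differentiableAt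
        ((isOpen_puncturedDisc s).mem_nhds hx)
    exact ((hΨ.diff t ht x hx _ (hball hx ht)).comp x
      (f := fun x => (x, flowJet n κ η v x t))
      (differentiableAt_id.prodMk hjet)).differentiableWithinAt
  · have hdist := hΨ.norm_sub_le (η := η) hA hκ le_rfl hv (admissible_zero zero_le_one) zero_le_one
      (by simpa using hv.bound) hx ht
    rw [flowJet_zero] at hdist
    calc ‖Ψ x t (flowJet n κ η v x t)‖
        = ‖Ψ x t (flowJet n κ η v x t) - Ψ x t 0 + Ψ x t 0‖ := by rw [sub_add_cancel]
      _ ≤ 1 / 2 + 1 / 2 := norm_add_le_of_le hdist (hΨ.zero x hx t ht)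
      _ = 1 := by norm_num

theorem admissible_iter (hΨ : IsContractive κ A s Ψ) (hA : RotInvariant A) (hκ : 1 ≤ κ) :
    ∀ m, Admissible A s 1 (contractionIter κ η Ψ m)
  | 0 => admissible_zero zero_le_one
  | m + 1 => hΨ.admissible hA hκ (hΨ.admissible_iter hA hκ m)

theorem norm_iter_sub_le (hΨ : IsContractive κ A s Ψ) (hA : RotInvariant A) (hκ : 1 ≤ κ)
    (hρ : ρ ≤ s) (hw : Admissible A ρ 1 w) (hE₀ : 0 ≤ E)
    (hE : ∀ x ∈ puncturedDisc ρ, ∀ t ∈ A, ‖Ψ x t (flowJet n κ η w x t) - w x t‖ ≤ E) (m : ℕ) :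
    ∀ x ∈ puncturedDisc ρ, ∀ t ∈ A,
      ‖contractionIter κ η Ψ m x t - w x t‖ ≤ (1 / 2) ^ m + 2 * E := by
  induction m with
  | zero =>
    intro x hx t ht
    have hbound := hw.bound x hx t ht
    simp only [contractionIter, zero_sub, norm_neg, pow_zero]
    linarith
  | succ m ih =>
    intro x hx t ht
    have hdist := hΨ.norm_sub_le (η := η) hA hκ hρ ((hΨ.admissible_iter hA hκ m).mono_radius hρ) hw
      (by positivity) ih hx ht
    calc ‖contractionIter κ η Ψ (m + 1) x t - w x t‖
        ≤ ((1 / 2) ^ m + 2 * E) / 2 + E := norm_sub_le_norm_sub_add_norm_sub _ _ _ |>.trans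
          (add_le_add hdist (hE x hx t ht))
      _ = (1 / 2) ^ (m + 1) + 2 * E := by ring

end IsContractive

theorem iterate_flowInt_eq_of_chain {w : ℕ → ℂ → ℂ → ℂ} (hA : RotInvariant A)
    (hw : ∀ i < n, ∀ x ∈ puncturedDisc ρ, ∀ t ∈ A, flowInt κ η (w (i + 1)) x t = w i x t) :
    ∀ m ≤ n, ∀ x ∈ puncturedDisc ρ, ∀ t ∈ A, (flowInt κ η)^[m] (w n) x t = w (n - m) x t := by
  intro m
  induction m with
  | zero => exact fun _ _ _ _ _ => rfl
  | succ m ih =>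
    intro hm x hx t ht
    obtain ⟨i, rfl⟩ := Nat.exists_eq_add_of_le hm
    rw [Function.iterate_succ_apply', flowInt_congr hA (ih (by omega)) hx ht,
      show m + 1 + i - m = i + 1 by omega, hw i (by omega) x hx t ht, Nat.add_sub_cancel_left]

theorem flowJet_eq_of_chain {w : ℕ → ℂ → ℂ → ℂ} (hA : RotInvariant A)
    (hw : ∀ i < n, ∀ x ∈ puncturedDisc ρ, ∀ t ∈ A, flowInt κ η (w (i + 1)) x t = w i x t)
    (hx : x ∈ puncturedDisc ρ) (ht : t ∈ A) :
    flowJet n κ η (w n) x t = fun i : Fin (n + 1) => w i x t := by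
  funext i
  rw [flowJet, iterate_flowInt_eq_of_chain hA hw _ (Nat.sub_le _ _) x hx t ht,
    Nat.sub_sub_self (Nat.lt_succ_iff.1 i.2)]

theorem IsContractive.norm_iteratedDeriv_le (hΨ : IsContractive κ A s Ψ) (hA : RotInvariant A)
    (hκ : 1 ≤ κ) (hs : 0 < s) {w : ℕ → ℂ → ℂ → ℂ} {ρ₀ C : ℝ} {k : ℕ} (hρ₀ : 0 < ρ₀) (hC : 0 ≤ C)
    (hwn : Admissible A ρ₀ 1 (w n))
    (hw : ∀ i < n, ∀ x ∈ puncturedDisc ρ₀, ∀ t ∈ A, flowInt κ η (w (i + 1)) x t = w i x t)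
    (hΨw : ∀ x ∈ puncturedDisc ρ₀, ∀ t ∈ A,
      ‖Ψ x t (fun i : Fin (n + 1) => w i x t) - w n x t‖ ≤ C * ‖x‖ ^ (k + 1))
    (ht : t ∈ A) (hw₀ : DifferentiableOn ℂ (fun x => w 0 x t) (ball 0 ρ₀)) :
    ‖iteratedDeriv k (fun x => w 0 x t) 0‖ ≤ k.factorial * (2 / s) ^ k := by
  have hiter := hΨ.admissible_iter (η := η) hA hκ
  have hflow := fun m => (hiter m).iterate_flowInt (η := η) hA hκ zero_le_one n
  rw [← one_mul ((2 / s) ^ k)]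
  refine norm_iteratedDeriv_zero_le_of_tendsto (C := 2 * C) (lt_min hs hρ₀) (min_le_left s ρ₀)
    (tendsto_pow_atTop_nhds_zero_of_lt_one (r := 1 / 2) (by norm_num) (by norm_num))
    (fun m => (hflow m).diff t ht) (fun m x hx => (hflow m).bound x hx t ht)
    (hw₀.mono (ball_subset_ball (min_le_right _ _))) fun ρ hρ m x hx => ?_
  obtain ⟨hρs, hρρ₀⟩ := le_min_iff.1 hρ.2
  have hsub := puncturedDisc_mono hρρ₀
  have hfix : ∀ x ∈ puncturedDisc ρ, ∀ t ∈ A,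
      ‖Ψ x t (flowJet n κ η (w n) x t) - w n x t‖ ≤ C * ρ ^ (k + 1) := by
    intro x hx t ht
    rw [flowJet_eq_of_chain hA hw (hsub hx) ht]
    refine (hΨw x (hsub hx) t ht).trans ?_
    have hxρ := hx.2.le
    gcongr
  have hρ₀' : 0 ≤ ρ := hρ.1.le
  have hdist := ((hiter m).mono_radius hρs).norm_iterate_flowInt_sub_le (η := η) hA hκ zero_le_one
    zero_le_one (hwn.mono_radius hρρ₀) (by positivity)
    (hΨ.norm_iter_sub_le hA hκ hρs (hwn.mono_radius hρρ₀) (by positivity) hfix m) n x hx t ht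
  rwa [iterate_flowInt_eq_of_chain hA hw n le_rfl x (hsub hx) t ht, Nat.sub_self,
    ← mul_assoc] at hdist

end Contraction

theorem isBigO_pow_pow_zero {a c : ℕ} (h : c ≤ a) :
    (fun x : ℂ => x ^ a) =O[𝓝 0] (fun x => x ^ c) := by
  rcases h.eq_or_lt with rfl | h
  · exact isBigO_refl _ _
  · exact (isLittleO_pow_pow h).isBigO

theorem isBigO_pow_iff_iteratedDeriv_eq_zero {f : ℂ → ℂ} (hf : AnalyticAt ℂ f 0) (m : ℕ) :
    f =O[𝓝 0] (fun x => x ^ m) ↔ ∀ i < m, iteratedDeriv i f 0 = 0 := by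
  rw [← natCast_le_analyticOrderAt_iff_iteratedDeriv_eq_zero hf]
  constructor
  · intro h
    by_contra! hlt
    obtain ⟨k, hk⟩ := ENat.ne_top_iff_exists.1 hlt.ne_top
    have hkm : k < m := by exact_mod_cast hk ▸ hlt
    obtain ⟨g, hg, hg0, hfg⟩ := hf.analyticOrderAt_eq_natCast.1 hk.symm
    have hpow : (fun x : ℂ => x ^ k) =O[𝓝 0] f := by
      refine ((isBigO_refl f _).mul ((hg.continuousAt.inv₀ hg0).isBigO_one ℂ)).congr' ?_
        (.of_forall fun x => mul_one _)
      filter_upwards [hfg, hg.continuousAt.eventually_ne hg0] with x hx hgx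
      simp [hx, hgx]
    have hne : ∃ᶠ x in 𝓝[≠] (0 : ℂ), x ^ k ≠ 0 :=
      (eventually_mem_nhdsWithin.mono fun _ hx => pow_ne_zero k hx : ∀ᶠ x in 𝓝[≠] (0 : ℂ),
        x ^ k ≠ 0).frequently
    exact isLittleO_irrefl (hne.filter_mono nhdsWithin_le_nhds)
      ((hpow.trans h).trans_isLittleO (isLittleO_pow_pow hkm))
  · intro h
    obtain ⟨g, hg, hfg⟩ := (natCast_le_analyticOrderAt hf).1 h
    refine ((isBigO_refl (fun x : ℂ => x ^ m) _).mul (hg.continuousAt.isBigO_one ℂ)).congr' ?_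
      (.of_forall fun x => mul_one _)
    filter_upwards [hfg] with x hx
    simp [hx]

section

variable {ι E : Type*} [NormedAddCommGroup E] [NormedSpace ℂ E] {l : Filter ι} {G : E → ℂ} {p₀ : E}
  {p q : ι → E}

theorem isBigO_comp_sub_comp (hG : AnalyticAt ℂ G p₀) (hp : Tendsto p l (𝓝 p₀))
    (hq : Tendsto q l (𝓝 p₀)) : (fun x => G (q x) - G (p x)) =O[l] (fun x => q x - p x) :=
  hG.hasStrictFDerivAt.isBigO_sub.comp_tendsto (hq.prodMk_nhds hp)

theorem isBigO_comp_sub_sub_fderiv (hG : AnalyticAt ℂ G p₀) (hp : Tendsto p l (𝓝 p₀))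
    (hq : Tendsto q l (𝓝 p₀)) :
    (fun x => G (q x) - G (p x) - fderiv ℂ G (p x) (q x - p x)) =O[l]
      (fun x => ‖q x - p x‖ ^ 2) := by
  obtain ⟨K, s, hs, hK⟩ := (hG.fderiv.contDiffAt (n := 1)).exists_lipschitzOnWith
  obtain ⟨ε, hε, hball⟩ := Metric.mem_nhds_iff.1 (inter_mem hs hG.eventually_analyticAt)
  refine IsBigO.of_bound K ?_
  filter_upwards [hp (ball_mem_nhds p₀ hε), hq (ball_mem_nhds p₀ hε)] with x hp hq
  have hconvex : Convex ℝ (ball p₀ ε ∩ closedBall (p x) ‖q x - p x‖) :=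
    (convex_ball _ _).inter (convex_closedBall _ _)
  have hderiv : ∀ z ∈ ball p₀ ε ∩ closedBall (p x) ‖q x - p x‖,
      ‖fderiv ℂ G z - fderiv ℂ G (p x)‖ ≤ K * ‖q x - p x‖ := fun z hz =>
    (hK.norm_sub_le (hball hz.1).1 (hball hp).1).trans
      (mul_le_mul_of_nonneg_left (mem_closedBall_iff_norm.1 hz.2) K.coe_nonneg)
  refine (hconvex.norm_image_sub_le_of_norm_hasFDerivWithin_le' (𝕜 := ℂ) (fun z hz =>
    (hball hz.1).2.differentiableAt.hasFDerivAt.hasFDerivWithinAt) hderiv ⟨hp, by simp⟩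
    ⟨hq, by simp [dist_eq_norm]⟩).trans_eq ?_
  rw [norm_pow, norm_norm]
  ring

end

section

variable {n : ℕ} {Y : Fin (n + 1) → ℕ → ℂ → ℂ} {t : ℂ} {G : ℂ × (Fin (n + 1) → ℂ) → ℂ}

/-- The point `(x, Y)` with the series `Y i` truncated before degree `L`. -/
def truncation (Y : Fin (n + 1) → ℕ → ℂ → ℂ) (L : ℕ) (t x : ℂ) : ℂ × (Fin (n + 1) → ℂ) :=
  (x, fun i => ∑ j ∈ Finset.range L, Y i j t * x ^ j)

/-- The point `(x, Y_L + x ^ m y)`, where `Y_L` is the truncation of the series `Y` before degree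
`L`. The equation `F(x, Φ) = 0` is studied through the substitution `Φ = Φ_{M + 1} + x ^ M y`. -/
def perturbation (Y : Fin (n + 1) → ℕ → ℂ → ℂ) (L m : ℕ) (t x : ℂ) (y : Fin (n + 1) → ℂ) :
    ℂ × (Fin (n + 1) → ℂ) :=
  truncation Y L t x + (0, x ^ m • y)

/-- The coefficient of `x ^ N` in `∂F/∂y_i (x, Y)`. -/
def leadCoeff (F : ℂ × (Fin (n + 1) → ℂ) → ℂ) (Y : Fin (n + 1) → ℕ → ℂ → ℂ) (N : ℕ)
    (i : Fin (n + 1)) (t : ℂ) : ℂ :=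
  substCoeff (partialY F i) Y N t

theorem differentiable_truncation (L : ℕ) : Differentiable ℂ (truncation Y L t) := by
  unfold truncation
  fun_prop

theorem truncation_zero {L : ℕ} (hL : 0 < L) : truncation Y L t 0 = (0, fun i => Y i 0 t) := by
  refine Prod.ext rfl (funext fun i => ?_)
  simp only [truncation]
  rw [Finset.sum_eq_single_of_mem 0 (Finset.mem_range.2 hL) fun j _ hj => by simp [hj]]
  simp

theorem tendsto_truncation {L : ℕ} (hL : 0 < L) :
    Tendsto (truncation Y L t) (𝓝 0) (𝓝 (0, fun i => Y i 0 t)) := by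
  rw [← truncation_zero hL]
  exact (differentiable_truncation L).continuous.tendsto 0

theorem isBigO_perturbation_sub (L m : ℕ) {h : ℂ → Fin (n + 1) → ℂ} (hh : ContinuousAt h 0) :
    (fun x => perturbation Y L m t x (h x) - truncation Y L t x) =O[𝓝 0] (fun x => x ^ m) := by
  simp only [perturbation, add_sub_cancel_left]
  refine IsBigO.prod_left (isBigO_zero _ _) ?_
  simpa using (isBigO_refl (fun x : ℂ => x ^ m) (𝓝 0)).smul (hh.isBigO_one ℂ)

theorem tendsto_perturbation {L m : ℕ} (hL : 0 < L) (hm : 0 < m) {h : ℂ → Fin (n + 1) → ℂ}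
    (hh : ContinuousAt h 0) :
    Tendsto (fun x => perturbation Y L m t x (h x)) (𝓝 0) (𝓝 (0, fun i => Y i 0 t)) := by
  have hpow : Tendsto (fun x : ℂ => x ^ m) (𝓝 0) (𝓝 0) := by
    simpa [hm.ne'] using (continuous_pow m).tendsto (0 : ℂ)
  have hdiff : Tendsto (fun x => perturbation Y L m t x (h x) - truncation Y L t x) (𝓝 0) (𝓝 0) :=
    (isBigO_perturbation_sub L m hh).trans_tendsto hpow
  simpa using hdiff.add (tendsto_truncation (Y := Y) (t := t) hL)

/-- The terms of degree `L, …, L + m - 1` of the series `Y`, divided by `x ^ L`. -/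
def tail (Y : Fin (n + 1) → ℕ → ℂ → ℂ) (L m : ℕ) (t x : ℂ) : Fin (n + 1) → ℂ :=
  fun i => ∑ j ∈ Finset.range m, Y i (L + j) t * x ^ j

theorem continuous_tail (L m : ℕ) : Continuous (tail Y L m t) := by
  unfold tail
  fun_prop

theorem perturbation_tail (L m : ℕ) (x : ℂ) :
    perturbation Y L L t x (tail Y L m t x) = truncation Y (L + m) t x := by
  refine Prod.ext (by simp [perturbation, truncation]) (funext fun i => ?_)
  simp only [perturbation, truncation, tail, Prod.snd_add, Pi.add_apply, Pi.smul_apply, smul_eq_mul,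
    Finset.sum_range_add, Finset.mul_sum, pow_add, mul_left_comm]

theorem analyticAt_comp_truncation (hG : AnalyticAt ℂ G (0, fun i => Y i 0 t)) {L : ℕ}
    (hL : 0 < L) : AnalyticAt ℂ (fun x => G (truncation Y L t x)) 0 := by
  rw [← truncation_zero hL] at hG
  exact hG.comp ((differentiable_truncation L).analyticAt 0)

theorem iteratedDeriv_comp_truncation (hG : AnalyticAt ℂ G (0, fun i => Y i 0 t)) {k L : ℕ}
    (hkL : k < L) :
    iteratedDeriv k (fun x => G (truncation Y L t x)) 0 = k.factorial * substCoeff G Y k t := by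
  obtain ⟨m, rfl⟩ := Nat.exists_eq_add_of_lt hkL
  rw [Nat.add_right_comm]
  have hlong := analyticAt_comp_truncation hG (L := k + 1 + m) (by omega)
  have hshort := analyticAt_comp_truncation hG k.succ_pos
  have htail : ContinuousAt (tail Y (k + 1) m t) 0 := (continuous_tail _ _).continuousAt
  have hO := (isBigO_comp_sub_comp hG (tendsto_truncation k.succ_pos)
    (tendsto_perturbation k.succ_pos k.succ_pos htail)).trans (isBigO_perturbation_sub _ _ htail)
  simp only [perturbation_tail] at hO
  have heq := (isBigO_pow_iff_iteratedDeriv_eq_zero (hlong.sub hshort) (k + 1)).1 hO k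
    k.lt_succ_self
  rw [iteratedDeriv_sub hlong.contDiffAt hshort.contDiffAt, sub_eq_zero] at heq
  rw [heq, substCoeff, mul_div_cancel₀ _ (Nat.cast_ne_zero.2 k.factorial_ne_zero)]
  rfl

theorem isBigO_comp_truncation (hG : AnalyticAt ℂ G (0, fun i => Y i 0 t)) {N L : ℕ}
    (h0 : ∀ k < N, substCoeff G Y k t = 0) (hL : 0 < L) (hNL : N ≤ L) :
    (fun x => G (truncation Y L t x)) =O[𝓝 0] (fun x => x ^ N) := by
  refine (isBigO_pow_iff_iteratedDeriv_eq_zero (analyticAt_comp_truncation hG hL) N).2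
    fun k hk => ?_
  rw [iteratedDeriv_comp_truncation hG (hk.trans_le hNL), h0 k hk, mul_zero]

theorem isBigO_comp_truncation_sub (hG : AnalyticAt ℂ G (0, fun i => Y i 0 t)) {N L : ℕ}
    (h0 : ∀ k < N, substCoeff G Y k t = 0) (hL : N < L) :
    (fun x => G (truncation Y L t x) - substCoeff G Y N t * x ^ N) =O[𝓝 0]
      (fun x => x ^ (N + 1)) := by
  have hcomp := analyticAt_comp_truncation hG (N.zero_le.trans_lt hL)
  have hmono : AnalyticAt ℂ (fun x : ℂ => substCoeff G Y N t * x ^ N) 0 := by fun_prop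
  refine (isBigO_pow_iff_iteratedDeriv_eq_zero (hcomp.sub hmono) (N + 1)).2 fun k hk => ?_
  rw [iteratedDeriv_sub hcomp.contDiffAt hmono.contDiffAt,
    iteratedDeriv_comp_truncation hG (by omega), iteratedDeriv_const_mul_field,
    iteratedDeriv_fun_pow_zero]
  rcases Nat.lt_succ_iff_lt_or_eq.1 hk with hkN | rfl
  · simp [h0 k hkN, hkN.ne]
  · simp [mul_comm]

theorem fderiv_zero_prod_eq_sum (p : ℂ × (Fin (n + 1) → ℂ)) (y : Fin (n + 1) → ℂ) :
    fderiv ℂ G p (0, y) = ∑ i, partialY G i p * y i := by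
  have hy : ((0 : ℂ), y) = ∑ i, y i • ((0 : ℂ), (Pi.single i 1 : Fin (n + 1) → ℂ)) := by
    refine Prod.ext (by simp [Prod.fst_sum]) ?_
    simp only [Prod.snd_sum, Prod.smul_snd]
    exact pi_eq_sum_univ' y
  simp only [hy, map_sum, map_smul, smul_eq_mul, partialY, mul_comm]

theorem analyticAt_partialY {p : ℂ × (Fin (n + 1) → ℂ)} (hG : AnalyticAt ℂ G p)
    (i : Fin (n + 1)) : AnalyticAt ℂ (partialY G i) p :=
  ((ContinuousLinearMap.apply ℂ ℂ ((0 : ℂ), (Pi.single i 1 : Fin (n + 1) → ℂ))).analyticAt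
    _).comp hG.fderiv

theorem isBigO_comp_perturbation_sub (hG : AnalyticAt ℂ G (0, fun i => Y i 0 t)) {L m : ℕ}
    (hL : 0 < L) (hm : 0 < m) {h : ℂ → Fin (n + 1) → ℂ} (hh : ContinuousAt h 0) :
    (fun x => G (perturbation Y L m t x (h x)) - G (truncation Y L t x) -
      x ^ m * ∑ i, partialY G i (truncation Y L t x) * h x i) =O[𝓝 0] (fun x => x ^ (2 * m)) := by
  have hquadratic := (isBigO_comp_sub_sub_fderiv hG (tendsto_truncation hL)
    (tendsto_perturbation hL hm hh)).trans ((isBigO_perturbation_sub L m hh).norm_left.pow 2)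
  refine hquadratic.congr (fun x => ?_) (fun x => by rw [← pow_mul, mul_comm])
  simp only [perturbation, add_sub_cancel_left, fderiv_zero_prod_eq_sum, Pi.smul_apply, smul_eq_mul,
    Finset.mul_sum, mul_left_comm]

/-- Truncating the solution before degree `L` costs only `x ^ (L + N)`: the omitted terms enter
through the partial derivatives, which are divisible by `x ^ N`. -/
theorem isBigO_comp_truncation_of_solution (hG : AnalyticAt ℂ G (0, fun i => Y i 0 t)) {N L : ℕ}
    (hsol : ∀ k, substCoeff G Y k t = 0)
    (h0 : ∀ i, ∀ k < N, substCoeff (partialY G i) Y k t = 0) (hL : 0 < L) (hNL : N ≤ L) :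
    (fun x => G (truncation Y L t x)) =O[𝓝 0] (fun x => x ^ (L + N)) := by
  have htail : ContinuousAt (tail Y L N t) 0 := (continuous_tail _ _).continuousAt
  have hlong : (fun x => G (truncation Y (L + N) t x)) =O[𝓝 0] (fun x => x ^ (L + N)) :=
    isBigO_comp_truncation hG (fun k _ => hsol k) (by omega) le_rfl
  have hquadratic := (isBigO_comp_perturbation_sub hG hL hL htail).trans
    (isBigO_pow_pow_zero (show L + N ≤ 2 * L by omega))
  simp only [perturbation_tail] at hquadratic
  have hlinear : (fun x => x ^ L * ∑ i, partialY G i (truncation Y L t x) * tail Y L N t x i)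
      =O[𝓝 0] (fun x => x ^ L * (x ^ N * 1)) :=
    (isBigO_refl _ _).mul (IsBigO.fun_sum fun i _ =>
      (isBigO_comp_truncation (analyticAt_partialY hG i) (h0 i) hL hNL).mul
        ((continuousAt_pi.1 htail i).isBigO_one ℂ))
  refine (hlong.sub (hquadratic.add (hlinear.congr_right fun x => ?_))).congr_left fun x => ?_ <;>
  ring

theorem isBigO_comp_perturbation_sub_leadCoeff (hG : AnalyticAt ℂ G (0, fun i => Y i 0 t))
    {N M : ℕ} (hsol : ∀ k, substCoeff G Y k t = 0)
    (h0 : ∀ i, ∀ k < N, substCoeff (partialY G i) Y k t = 0) (hNM : N < M) (y : Fin (n + 1) → ℂ) :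
    (fun x => G (perturbation Y (M + 1) M t x y) - (∑ i, leadCoeff G Y N i t * y i) * x ^ (M + N))
      =O[𝓝 0] (fun x => x ^ (M + N + 1)) := by
  have hbase := (isBigO_comp_truncation_of_solution hG hsol h0 M.succ_pos (by omega)).trans
    (isBigO_pow_pow_zero (show M + N + 1 ≤ M + 1 + N by omega))
  have hquadratic := (isBigO_comp_perturbation_sub hG M.succ_pos (by omega) (h := fun _ => y)
    continuousAt_const).trans (isBigO_pow_pow_zero (show M + N + 1 ≤ 2 * M by omega))
  have hlinear : (fun x => x ^ M * ∑ i, (partialY G i (truncation Y (M + 1) t x) -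
      leadCoeff G Y N i t * x ^ N) * y i) =O[𝓝 0] (fun x => x ^ M * (x ^ (N + 1) * 1)) :=
    (isBigO_refl _ _).mul (IsBigO.fun_sum fun i _ =>
      (isBigO_comp_truncation_sub (analyticAt_partialY hG i) (h0 i) (by omega)).mul
        (isBigO_const_const _ one_ne_zero _))
  refine ((hquadratic.add hbase).add (hlinear.congr_right fun x => ?_)).congr_left fun x => ?_
  · ring
  · simp only [sub_mul, Finset.sum_sub_distrib, mul_right_comm _ (x ^ N), ← Finset.sum_mul]
    ring

end

theorem norm_le_mul_div_pow {f : ℂ → ℂ} {R C : ℝ} {m : ℕ}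
    (hd : DifferentiableOn ℂ f (ball 0 R)) (hC : ∀ x ∈ ball (0 : ℂ) R, ‖f x‖ ≤ C)
    (hO : f =O[𝓝 0] (fun x => x ^ (m + 1))) {x : ℂ} (hx : x ∈ ball (0 : ℂ) R) :
    ‖f x‖ ≤ C * (‖x‖ / R) ^ (m + 1) := by
  have hf0 : f 0 = 0 := (hO.norm_right.congr_right (g₂ := fun x : ℂ => ‖x - 0‖ ^ (m + 1))
    fun x => by simp).eq_zero_of_norm_pow m.succ_ne_zero
  have ho : (f · - f 0) =o[𝓝 0] (fun x : ℂ => ‖x - 0‖ ^ m) := by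
    simpa [hf0] using (hO.trans_isLittleO (isLittleO_pow_pow m.lt_succ_self)).norm_right
  simpa [hf0] using Complex.dist_le_mul_div_pow_of_mapsTo_ball_of_isLittleO (R₂ := C) hd
    (fun z hz => by simpa [hf0] using hC z hz) ho hx

theorem norm_sub_le_of_differentiableOn_ball {E F : Type*} [NormedAddCommGroup E] [NormedSpace ℂ E]
    [NormedAddCommGroup F] [NormedSpace ℂ F] {f : E → F} {a R c : ℝ}
    (hf : DifferentiableOn ℂ f (ball 0 R)) (hc : ∀ y ∈ ball (0 : E) R, ‖f y‖ ≤ c) (haR : a < R)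
    {y y' : E} (hy : y ∈ closedBall 0 a) (hy' : y' ∈ closedBall 0 a) :
    ‖f y - f y'‖ ≤ 2 * c / (R - a) * ‖y - y'‖ := by
  let : NormedSpace ℝ E := NormedSpace.restrictScalars ℝ ℂ E
  have hball : ∀ z ∈ closedBall (0 : E) a, ball z (R - a) ⊆ ball 0 R := fun z hz =>
    ball_subset_ball' (by linarith [mem_closedBall.1 hz])
  have hmem : ∀ z ∈ closedBall (0 : E) a, z ∈ ball (0 : E) R := fun z hz =>
    closedBall_subset_ball haR hz
  refine (convex_closedBall (0 : E) a).norm_image_sub_le_of_norm_fderiv_le (𝕜 := ℂ)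
    (fun z hz => hf.differentiableAt (isOpen_ball.mem_nhds (hmem z hz))) (fun z hz => ?_) hy' hy
  refine Complex.norm_fderiv_le_div_of_mapsTo_ball (hf.mono (hball z hz)) (fun u hu => ?_)
    (sub_pos.2 haR)
  rw [mem_closedBall, dist_eq_norm, two_mul]
  exact norm_sub_le_of_le (hc u (hball z hz hu)) (hc z (hmem z hz))

theorem tendstoLocallyUniformlyOn_iteratedDeriv {ι : Type*} {l : Filter ι} [l.NeBot]
    {f : ι → ℂ → ℂ} {g : ℂ → ℂ} {U : Set ℂ} (hU : IsOpen U)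
    (hd : ∀ᶠ i in l, DifferentiableOn ℂ (f i) U) (hfg : TendstoLocallyUniformlyOn f g l U) (k : ℕ) :
    TendstoLocallyUniformlyOn (fun i => iteratedDeriv k (f i)) (iteratedDeriv k g) l U := by
  induction k with
  | zero => simpa only [iteratedDeriv_zero] using hfg
  | succ k ih =>
    simp only [iteratedDeriv_succ]
    refine ih.deriv ?_ hU
    filter_upwards [hd] with i hi x hx
    have han : AnalyticAt ℂ (f i) x := hi.analyticAt (hU.mem_nhds hx)
    rw [iteratedDeriv_eq_iterate]
    exact (han.iterated_deriv k).differentiableAt.differentiableWithinAt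

theorem continuousAt_iteratedDeriv {X : Type*} [TopologicalSpace X] {f : X → ℂ → ℂ} {t : X}
    {U : Set ℂ} (hU : IsOpen U) (hd : ∀ᶠ t' in 𝓝 t, DifferentiableOn ℂ (f t') U)
    (hc : ∀ x ∈ U, ContinuousAt (fun q : X × ℂ => f q.1 q.2) (t, x)) (k : ℕ) {x : ℂ} (hx : x ∈ U) :
    ContinuousAt (fun t => iteratedDeriv k (f t) x) t := by
  have hloc : TendstoLocallyUniformlyOn f (f t) (𝓝 t) U := by
    refine hU.tendstoLocallyUniformlyOn_iff_forall_tendsto.2 fun x hx => ?_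
    have hft : ContinuousAt (f t) x := (hc x hx).comp (f := fun x => (t, x)) (by fun_prop)
    have hfq := (hc x hx).tendsto
    rw [nhds_prod_eq] at hfq
    exact ((hft.tendsto.comp tendsto_snd).prodMk_nhds hfq).mono_right (nhds_le_uniformity (f t x))
  exact (tendstoLocallyUniformlyOn_iteratedDeriv hU hd hloc k).tendsto_at hx

section

variable {n N : ℕ} {Y : Fin (n + 1) → ℕ → ℂ → ℂ} {A : Set ℂ} {Δ : Set (ℂ × (Fin (n + 1) → ℂ))}
  {F : ℂ × (Fin (n + 1) → ℂ) → ℂ} {t : ℂ}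

theorem continuousAt_perturbation (hY : ∀ i j, ContinuousAt (Y i j) t) (L m : ℕ) (x : ℂ)
    (y : Fin (n + 1) → ℂ) : ContinuousAt (fun q : ℂ × ℂ × (Fin (n + 1) → ℂ) =>
      perturbation Y L m q.2.1 q.1 q.2.2) (x, t, y) := by
  have hYq : ∀ i j, ContinuousAt (fun q : ℂ × ℂ × (Fin (n + 1) → ℂ) => Y i j q.2.1) (x, t, y) :=
    fun i j => (hY i j).comp (f := fun q : ℂ × ℂ × (Fin (n + 1) → ℂ) => q.2.1) (by fun_prop)
  unfold perturbation truncation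
  refine ContinuousAt.add (continuousAt_fst.prodMk (continuousAt_pi.2 fun i => ?_)) (by fun_prop)
  exact tendsto_finsetSum _ fun j _ => (hYq i j).mul (by fun_prop)

theorem perturbation_zero {L m : ℕ} {x : ℂ} : perturbation Y L m t x 0 = truncation Y L t x := by
  simp [perturbation]

theorem continuousAt_truncation (hY : ∀ i j, ContinuousAt (Y i j) t) (L : ℕ) (x : ℂ) :
    ContinuousAt (fun q : ℂ × ℂ => truncation Y L q.1 q.2) (t, x) := by
  have h := (continuousAt_perturbation hY L 0 x 0).comp (x := (t, x))
    (f := fun q : ℂ × ℂ => (q.2, q.1, (0 : Fin (n + 1) → ℂ))) (by fun_prop)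
  simpa only [Function.comp_def, perturbation_zero] using h

theorem continuousAt_substCoeff {G : ℂ × (Fin (n + 1) → ℂ) → ℂ}
    (hG : AnalyticAt ℂ G (0, fun i => Y i 0 t)) (hY : ∀ i j, ContinuousAt (Y i j) t) (k : ℕ) :
    ContinuousAt (substCoeff G Y k) t := by
  have hcont := continuousAt_truncation hY (k + 1)
  have hnear : ∀ᶠ q : ℂ × ℂ in 𝓝 t ×ˢ 𝓝 0, AnalyticAt ℂ G (truncation Y (k + 1) q.1 q.2) := by
    rw [← nhds_prod_eq]
    refine (hcont 0).eventually ?_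
    simpa only [truncation_zero k.succ_pos] using hG.eventually_analyticAt
  obtain ⟨P, hP, Q, hQ, hPQ⟩ := eventually_prod_iff.1 hnear
  obtain ⟨R, hR, hball⟩ := Metric.mem_nhds_iff.1 hQ
  refine (continuousAt_iteratedDeriv isOpen_ball (hP.mono fun t' ht' x hx => ?_) (fun x hx => ?_) k
    (mem_ball_self hR)).div_const _
  · exact ((hPQ ht' (hball hx)).differentiableAt.comp x
      (differentiable_truncation _ x)).differentiableWithinAt
  · exact (hPQ hP.self_of_nhds (hball hx)).continuousAt.comp
      (f := fun q : ℂ × ℂ => truncation Y (k + 1) q.1 q.2) (hcont x)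

/-- At `t`, the coefficients of the series `Y` are continuous and `Y` solves `F(x, Y) = 0` in such a
way that all the `∂F/∂y_i (x, Y)` are divisible by `x ^ N`. -/
structure IsSolutionAt (Δ : Set (ℂ × (Fin (n + 1) → ℂ))) (F : ℂ × (Fin (n + 1) → ℂ) → ℂ)
    (Y : Fin (n + 1) → ℕ → ℂ → ℂ) (N : ℕ) (t : ℂ) : Prop where
  cont : ∀ i j, ContinuousAt (Y i j) t
  mem : ((0 : ℂ), fun i => Y i 0 t) ∈ Δ
  substCoeff_eq_zero : ∀ k, substCoeff F Y k t = 0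
  substCoeff_partialY_eq_zero : ∀ i, ∀ k < N, substCoeff (partialY F i) Y k t = 0

theorem IsSolutionAt.continuousAt_leadCoeff (h : IsSolutionAt Δ F Y N t)
    (hF : AnalyticOnNhd ℂ F Δ) (i : Fin (n + 1)) : ContinuousAt (leadCoeff F Y N i) t :=
  continuousAt_substCoeff (analyticAt_partialY (hF _ h.mem) i) h.cont N

theorem exists_radius_norm_perturbation_le (hA : IsCompact A) (hΔ : IsOpen Δ)
    (hF : ContinuousOn F Δ) (hY : ∀ t ∈ A, ∀ i j, ContinuousAt (Y i j) t)
    (h0 : ∀ t ∈ A, (0, fun i => Y i 0 t) ∈ Δ) {L m : ℕ} (hL : 0 < L) (hm : 0 < m) (a : ℝ) :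
    ∃ R C : ℝ, 0 < R ∧ R ≤ 1 ∧ 0 ≤ C ∧ ∀ x ∈ closedBall (0 : ℂ) R, ∀ t ∈ A,
      ∀ y ∈ closedBall (0 : Fin (n + 1) → ℂ) a,
        perturbation Y L m t x y ∈ Δ ∧ ‖F (perturbation Y L m t x y)‖ ≤ C := by
  have hK : IsCompact (A ×ˢ closedBall (0 : Fin (n + 1) → ℂ) a) :=
    hA.prod (isCompact_closedBall _ _)
  have hmem : ∀ᶠ x in 𝓝 (0 : ℂ), ∀ q ∈ A ×ˢ closedBall (0 : Fin (n + 1) → ℂ) a,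
      perturbation Y L m q.1 x q.2 ∈ Δ := by
    refine hK.eventually_forall_of_forall_eventually fun q hq => ?_
    refine (continuousAt_perturbation (hY q.1 hq.1) L m 0 q.2).eventually_mem (hΔ.mem_nhds ?_)
    simpa [perturbation, truncation_zero hL, hm.ne'] using h0 q.1 hq.1
  obtain ⟨R, hR, hball⟩ := Metric.nhds_basis_closedBall.mem_iff.1 hmem
  have hR' : closedBall (0 : ℂ) (min R 1) ⊆ closedBall 0 R :=
    closedBall_subset_closedBall (min_le_left _ _)
  obtain ⟨C, hC⟩ := ((isCompact_closedBall (0 : ℂ) (min R 1)).prod hK).exists_bound_of_continuousOn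
    (f := fun q => F (perturbation Y L m q.2.1 q.1 q.2.2))
    (hF.comp (fun q hq => (continuousAt_perturbation (hY q.2.1 hq.2.1) L m q.1
      q.2.2).continuousWithinAt) (fun q hq => hball (hR' hq.1) q.2 hq.2))
  exact ⟨min R 1, max C 0, lt_min hR one_pos, min_le_right _ _, le_max_right _ _,
    fun x hx t ht y hy => ⟨hball (hR' hx) (t, y) ⟨ht, hy⟩,
      (hC (x, t, y) ⟨hx, ht, hy⟩).trans (le_max_left _ _)⟩⟩

theorem exists_norm_comp_truncation_le (hA : IsCompact A) (hΔ : IsOpen Δ)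
    (hF : AnalyticOnNhd ℂ F Δ) (hY : ∀ t ∈ A, IsSolutionAt Δ F Y N t) (L : ℕ) :
    ∃ R C : ℝ, 0 < R ∧ 0 ≤ C ∧ ∀ x ∈ ball (0 : ℂ) R, ∀ t ∈ A,
      ‖F (truncation Y (L + 1) t x)‖ ≤ C * ‖x‖ ^ (L + 1) := by
  obtain ⟨R, C, hR, -, hC, hbound⟩ := exists_radius_norm_perturbation_le hA hΔ hF.continuousOn
    (fun t ht => (hY t ht).cont) (fun t ht => (hY t ht).mem) L.succ_pos one_pos 0
  simp only [closedBall_zero, mem_singleton_iff, forall_eq, perturbation_zero] at hbound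
  have hball : ∀ x ∈ ball (0 : ℂ) R, x ∈ closedBall (0 : ℂ) R := fun x hx =>
    ball_subset_closedBall hx
  refine ⟨R, C / R ^ (L + 1), hR, by positivity, fun x hx t ht => ?_⟩
  have hd : DifferentiableOn ℂ (fun x => F (truncation Y (L + 1) t x)) (ball 0 R) := fun x hx =>
    ((hF _ (hbound x (hball x hx) t ht).1).differentiableAt.comp x
      (differentiable_truncation _ x)).differentiableWithinAt
  have hO := isBigO_comp_truncation (hF _ (hY t ht).mem)
    (fun k _ => (hY t ht).substCoeff_eq_zero k) L.succ_pos le_rfl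
  exact (norm_le_mul_div_pow hd (fun x hx => (hbound x (hball x hx) t ht).2) hO hx).trans_eq
    (by rw [div_pow]; ring)

theorem differentiable_perturbation (L m : ℕ) :
    Differentiable ℂ (fun q : ℂ × (Fin (n + 1) → ℂ) => perturbation Y L m t q.1 q.2) := by
  unfold perturbation truncation
  fun_prop

/-- The difference between `F(x, Y_{M+1} + x ^ M y) / x ^ (M + N)` and its limit as `x → 0`. -/
def remainder (F : ℂ × (Fin (n + 1) → ℂ) → ℂ) (Y : Fin (n + 1) → ℕ → ℂ → ℂ) (M N : ℕ) (t x : ℂ)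
    (y : Fin (n + 1) → ℂ) : ℂ :=
  F (perturbation Y (M + 1) M t x y) / x ^ (M + N) - ∑ i, leadCoeff F Y N i t * y i

theorem norm_remainder_le (hF : AnalyticOnNhd ℂ F Δ) (hY : IsSolutionAt Δ F Y N t) {M : ℕ}
    (hNM : N < M) {y : Fin (n + 1) → ℂ} {R C S : ℝ} (hR : R ≤ 1)
    (hC : ∀ x ∈ ball (0 : ℂ) R, perturbation Y (M + 1) M t x y ∈ Δ ∧
      ‖F (perturbation Y (M + 1) M t x y)‖ ≤ C)
    (hS : ‖∑ i, leadCoeff F Y N i t * y i‖ ≤ S) {x : ℂ} (hx : x ∈ puncturedDisc R) :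
    ‖remainder F Y M N t x y‖ ≤ (C + S) / R ^ (M + N + 1) * ‖x‖ := by
  have hx0 : x ≠ 0 := norm_pos_iff.1 hx.1
  have hd : DifferentiableOn ℂ (fun x => F (perturbation Y (M + 1) M t x y) -
      (∑ i, leadCoeff F Y N i t * y i) * x ^ (M + N)) (ball 0 R) := fun x hx =>
    DifferentiableAt.differentiableWithinAt <| .sub ((hF _ (hC x hx).1).differentiableAt.comp
      (f := fun x => perturbation Y (M + 1) M t x y) x
      ((differentiable_perturbation _ _ _).comp (f := fun x => (x, y)) x (by fun_prop)))
      (by fun_prop)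
  have hbound : ∀ x ∈ ball (0 : ℂ) R, ‖F (perturbation Y (M + 1) M t x y) -
      (∑ i, leadCoeff F Y N i t * y i) * x ^ (M + N)‖ ≤ C + S := by
    intro x hx
    refine norm_sub_le_of_le (hC x hx).2 ?_
    rw [norm_mul, norm_pow]
    have hx1 : ‖x‖ ≤ 1 := (mem_ball_zero_iff.1 hx).le.trans hR
    exact (mul_le_of_le_one_right (norm_nonneg _) (pow_le_one₀ (norm_nonneg _) hx1)).trans hS
  have hschwarz := norm_le_mul_div_pow hd hbound (isBigO_comp_perturbation_sub_leadCoeff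
    (hF _ hY.mem) hY.substCoeff_eq_zero hY.substCoeff_partialY_eq_zero hNM y)
    (mem_ball_zero_iff.2 hx.2)
  have hdiv : remainder F Y M N t x y = (F (perturbation Y (M + 1) M t x y) -
      (∑ i, leadCoeff F Y N i t * y i) * x ^ (M + N)) / x ^ (M + N) := by
    rw [remainder, sub_div, mul_div_cancel_right₀ _ (pow_ne_zero _ hx0)]
  rw [hdiv, norm_div, div_le_iff₀ (norm_pos_iff.2 (pow_ne_zero _ hx0)), norm_pow]
  exact hschwarz.trans_eq (by rw [div_pow]; ring)

theorem exists_radius_norm_remainder_le (hA : IsCompact A) (hΔ : IsOpen Δ)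
    (hF : AnalyticOnNhd ℂ F Δ) (hY : ∀ t ∈ A, IsSolutionAt Δ F Y N t) {M : ℕ} (hNM : N < M)
    {a c : ℝ} (hc : 0 < c) :
    ∃ s : ℝ, 0 < s ∧ ∀ x ∈ puncturedDisc s, ∀ t ∈ A, ∀ y ∈ closedBall (0 : Fin (n + 1) → ℂ) a,
      perturbation Y (M + 1) M t x y ∈ Δ ∧ ‖remainder F Y M N t x y‖ ≤ c := by
  obtain ⟨R, C, hR, hR1, hC, hbound⟩ := exists_radius_norm_perturbation_le hA hΔ hF.continuousOn
    (fun t ht => (hY t ht).cont) (fun t ht => (hY t ht).mem) M.succ_pos (N.zero_le.trans_lt hNM) a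
  have hlead : ContinuousOn (fun q : ℂ × (Fin (n + 1) → ℂ) => ∑ i, leadCoeff F Y N i q.1 * q.2 i)
      (A ×ˢ closedBall 0 a) := continuousOn_finsetSum _ fun i _ =>
    ContinuousOn.mul (fun q hq => (((hY q.1 hq.1).continuousAt_leadCoeff hF i).comp
      (f := Prod.fst) continuousAt_fst).continuousWithinAt) (by fun_prop)
  obtain ⟨S, hS⟩ := (hA.prod (isCompact_closedBall _ _)).exists_bound_of_continuousOn hlead
  set K := (C + |S|) / R ^ (M + N + 1)
  refine ⟨min R (c / (K + 1)), by positivity, fun x hx t ht y hy => ?_⟩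
  have hxR : x ∈ puncturedDisc R := puncturedDisc_mono (min_le_left _ _) hx
  have hxc : ‖x‖ * (K + 1) < c := (lt_div_iff₀ (by positivity)).1 (hx.2.trans_le (min_le_right _ _))
  have hball : ∀ x ∈ ball (0 : ℂ) R, perturbation Y (M + 1) M t x y ∈ Δ ∧
      ‖F (perturbation Y (M + 1) M t x y)‖ ≤ C := fun x hx =>
    hbound x (ball_subset_closedBall hx) t ht y hy
  refine ⟨(hball x (mem_ball_zero_iff.2 hxR.2)).1, (norm_remainder_le hF (hY t ht) hNM hR1 hball
    ((hS (t, y) ⟨ht, hy⟩).trans (le_abs_self S)) hxR).trans ?_⟩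
  linarith [norm_nonneg x]

/-- The fixed-point form `Ψ(x, t, y) = y_n` of the equation `F(x, Y_{M+1} + x ^ M y) = 0`, where
`Y_{M+1}` is a truncation of a formal solution. -/
def fixedPointMap (F : ℂ × (Fin (n + 1) → ℂ) → ℂ) (Y : Fin (n + 1) → ℕ → ℂ → ℂ) (M N : ℕ)
    (x t : ℂ) (y : Fin (n + 1) → ℂ) : ℂ :=
  y (Fin.last n) -
    F (perturbation Y (M + 1) M t x y) / x ^ (M + N) / leadCoeff F Y N (Fin.last n) t

theorem fixedPointMap_eq (hlead : leadCoeff F Y N (Fin.last n) t ≠ 0) (M : ℕ) (x : ℂ)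
    (y : Fin (n + 1) → ℂ) :
    fixedPointMap F Y M N x t y =
      -∑ i : Fin n, leadCoeff F Y N i.castSucc t / leadCoeff F Y N (Fin.last n) t * y i.castSucc -
        remainder F Y M N t x y / leadCoeff F Y N (Fin.last n) t := by
  simp only [fixedPointMap, remainder, Fin.sum_univ_castSucc, sub_div, add_div, Finset.sum_div,
    mul_div_right_comm, div_self hlead]
  ring

theorem fixedPointMap_zero (hlead : leadCoeff F Y N (Fin.last n) t ≠ 0) (M : ℕ) (x : ℂ) :
    fixedPointMap F Y M N x t 0 =
      -(remainder F Y M N t x 0 * (leadCoeff F Y N (Fin.last n) t)⁻¹) := by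
  simp [fixedPointMap_eq hlead, div_eq_mul_inv]

theorem differentiableAt_fixedPointMap (hF : AnalyticOnNhd ℂ F Δ) {M : ℕ} {x : ℂ} (hx : x ≠ 0)
    {y : Fin (n + 1) → ℂ} (hy : perturbation Y (M + 1) M t x y ∈ Δ) :
    DifferentiableAt ℂ (fun q : ℂ × (Fin (n + 1) → ℂ) => fixedPointMap F Y M N q.1 t q.2)
      (x, y) := by
  have hFp : DifferentiableAt ℂ (fun q : ℂ × (Fin (n + 1) → ℂ) =>
      F (perturbation Y (M + 1) M t q.1 q.2)) (x, y) :=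
    (hF _ hy).differentiableAt.comp (x, y) (differentiable_perturbation _ _ _)
  have hpow : (x, y).1 ^ (M + N) ≠ 0 := pow_ne_zero _ hx
  simp only [fixedPointMap, div_eq_mul_inv]
  exact DifferentiableAt.sub (by fun_prop)
    ((hFp.mul (DifferentiableAt.fun_inv (by fun_prop) hpow)).mul_const _)

theorem continuousAt_fixedPointMap (hF : AnalyticOnNhd ℂ F Δ) (hY : IsSolutionAt Δ F Y N t)
    (hlead : leadCoeff F Y N (Fin.last n) t ≠ 0) {M : ℕ} {x : ℂ} (hx : x ≠ 0)
    {y : Fin (n + 1) → ℂ} (hy : perturbation Y (M + 1) M t x y ∈ Δ) :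
    ContinuousAt (fun q : ℂ × ℂ × (Fin (n + 1) → ℂ) => fixedPointMap F Y M N q.1 q.2.1 q.2.2)
      (x, t, y) := by
  have hFp : ContinuousAt (fun q : ℂ × ℂ × (Fin (n + 1) → ℂ) =>
      F (perturbation Y (M + 1) M q.2.1 q.1 q.2.2)) (x, t, y) :=
    (hF _ hy).continuousAt.comp (f := fun q : ℂ × ℂ × (Fin (n + 1) → ℂ) =>
      perturbation Y (M + 1) M q.2.1 q.1 q.2.2) (continuousAt_perturbation hY.cont _ _ _ _)
  have hlast : ContinuousAt (fun q : ℂ × ℂ × (Fin (n + 1) → ℂ) =>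
      leadCoeff F Y N (Fin.last n) q.2.1) (x, t, y) :=
    (hY.continuousAt_leadCoeff hF _).comp
      (f := fun q : ℂ × ℂ × (Fin (n + 1) → ℂ) => q.2.1) (by fun_prop)
  have hpow : (x, t, y).1 ^ (M + N) ≠ 0 := pow_ne_zero _ hx
  unfold fixedPointMap
  exact ContinuousAt.sub (by fun_prop) ((hFp.div (by fun_prop) hpow).div hlast hlead)

theorem norm_fixedPointMap_sub_le (hF : AnalyticOnNhd ℂ F Δ)
    (hlead : leadCoeff F Y N (Fin.last n) t ≠ 0) {M : ℕ} {x : ℂ} {a R c : ℝ}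
    (hpert : ∀ y ∈ ball (0 : Fin (n + 1) → ℂ) R, perturbation Y (M + 1) M t x y ∈ Δ)
    (hc : ∀ y ∈ ball (0 : Fin (n + 1) → ℂ) R, ‖remainder F Y M N t x y‖ ≤ c) (haR : a < R)
    {y y' : Fin (n + 1) → ℂ} (hy : y ∈ closedBall 0 a) (hy' : y' ∈ closedBall 0 a) :
    ‖fixedPointMap F Y M N x t y - fixedPointMap F Y M N x t y'‖ ≤
      ∑ i : Fin n, ‖leadCoeff F Y N i.castSucc t / leadCoeff F Y N (Fin.last n) t‖ *
          ‖y i.castSucc - y' i.castSucc‖ +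
        2 * c / (R - a) * ‖y - y'‖ * ‖(leadCoeff F Y N (Fin.last n) t)⁻¹‖ := by
  have hd : DifferentiableOn ℂ (remainder F Y M N t x) (ball 0 R) := by
    intro y hy
    have hFp : DifferentiableAt ℂ (fun y => F (perturbation Y (M + 1) M t x y)) y :=
      (hF _ (hpert y hy)).differentiableAt.comp y
        ((differentiable_perturbation _ _ _).comp (f := fun y => (x, y)) y (by fun_prop))
    unfold remainder
    simp only [div_eq_mul_inv]
    exact ((hFp.mul_const _).sub (by fun_prop)).differentiableWithinAt
  have hlip := norm_sub_le_of_differentiableOn_ball hd hc haR hy hy'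
  have hsub : fixedPointMap F Y M N x t y - fixedPointMap F Y M N x t y' =
      -∑ i : Fin n, leadCoeff F Y N i.castSucc t / leadCoeff F Y N (Fin.last n) t *
          (y i.castSucc - y' i.castSucc) -
        (remainder F Y M N t x y - remainder F Y M N t x y') *
          (leadCoeff F Y N (Fin.last n) t)⁻¹ := by
    rw [fixedPointMap_eq hlead, fixedPointMap_eq hlead]
    simp only [mul_sub, Finset.sum_sub_distrib]
    ring
  rw [hsub]
  refine norm_sub_le_of_le ?_ ?_
  · rw [norm_neg]
    exact norm_sum_le_of_le _ fun i _ => (norm_mul _ _).le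
  · rw [norm_mul]
    gcongr

theorem norm_fixedPointMap_sub_le_half (hF : AnalyticOnNhd ℂ F Δ)
    (hlead : leadCoeff F Y N (Fin.last n) t ≠ 0) {M : ℕ} {x : ℂ} {c β γ E : ℝ}
    (hrem : ∀ y ∈ closedBall (0 : Fin (n + 1) → ℂ) 3,
      perturbation Y (M + 1) M t x y ∈ Δ ∧ ‖remainder F Y M N t x y‖ ≤ c)
    (hβ : ∑ i : Fin n, ‖leadCoeff F Y N i.castSucc t / leadCoeff F Y N (Fin.last n) t‖ ≤ β)
    (hγ : ‖(leadCoeff F Y N (Fin.last n) t)⁻¹‖ ≤ γ) (hβM : 4 * β < M) (hγc : 4 * (c * γ) ≤ 1)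
    {y y' : Fin (n + 1) → ℂ} (hy : y ∈ closedBall 0 1) (hy' : y' ∈ closedBall 0 1)
    (hE : ∀ i, ‖y i - y' i‖ ≤ E) (hEM : ∀ i ≠ Fin.last n, ‖y i - y' i‖ ≤ E / M) :
    ‖fixedPointMap F Y M N x t y - fixedPointMap F Y M N x t y'‖ ≤ E / 2 := by
  have hE0 : 0 ≤ E := (norm_nonneg _).trans (hE 0)
  have hc0 : 0 ≤ c := (norm_nonneg _).trans (hrem 0 (mem_closedBall_self (by norm_num))).2
  have hβ0 : 0 ≤ β := (Finset.sum_nonneg fun i _ => norm_nonneg _).trans hβ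
  have hyy' : ‖y - y'‖ ≤ E := (pi_norm_le_iff_of_nonneg hE0).2 hE
  have hβE : β * (E / M) ≤ E / 4 := by
    rw [mul_div_assoc', div_le_div_iff₀ (by linarith) (by norm_num)]
    nlinarith
  refine (norm_fixedPointMap_sub_le hF hlead (fun z hz => (hrem z (ball_subset_closedBall hz)).1)
    (fun z hz => (hrem z (ball_subset_closedBall hz)).2) (by norm_num) hy hy').trans ?_
  set l := leadCoeff F Y N (Fin.last n) t
  calc ∑ i : Fin n, ‖leadCoeff F Y N i.castSucc t / l‖ * ‖y i.castSucc - y' i.castSucc‖ +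
        2 * c / (3 - 1) * ‖y - y'‖ * ‖l⁻¹‖
      ≤ ∑ i : Fin n, ‖leadCoeff F Y N i.castSucc t / l‖ * (E / M) +
          2 * c / (3 - 1) * E * γ := by
        gcongr with i
        exact hEM _ i.castSucc_ne_last
    _ ≤ β * (E / M) + 2 * c / (3 - 1) * E * γ := by
        rw [← Finset.sum_mul]
        gcongr
    _ ≤ E / 2 := by nlinarith

theorem isContractive_fixedPointMap (hF : AnalyticOnNhd ℂ F Δ)
    (hY : ∀ t ∈ A, IsSolutionAt Δ F Y N t)
    (hlead : ∀ t ∈ A, leadCoeff F Y N (Fin.last n) t ≠ 0) {M : ℕ} {s c β γ : ℝ}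
    (hrem : ∀ x ∈ puncturedDisc s, ∀ t ∈ A, ∀ y ∈ closedBall (0 : Fin (n + 1) → ℂ) 3,
      perturbation Y (M + 1) M t x y ∈ Δ ∧ ‖remainder F Y M N t x y‖ ≤ c)
    (hβ : ∀ t ∈ A, ∑ i : Fin n,
      ‖leadCoeff F Y N i.castSucc t / leadCoeff F Y N (Fin.last n) t‖ ≤ β)
    (hγ : ∀ t ∈ A, ‖(leadCoeff F Y N (Fin.last n) t)⁻¹‖ ≤ γ) (hβM : 4 * β < M)
    (hγc : 4 * (c * γ) ≤ 1) : IsContractive M A s (fixedPointMap F Y M N) := by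
  have hpert : ∀ x ∈ puncturedDisc s, ∀ t ∈ A, ∀ y ∈ closedBall (0 : Fin (n + 1) → ℂ) 1,
      perturbation Y (M + 1) M t x y ∈ Δ := fun x hx t ht y hy =>
    (hrem x hx t ht y (closedBall_subset_closedBall (by norm_num) hy)).1
  have hc : ∀ x ∈ puncturedDisc s, ∀ t ∈ A, ‖remainder F Y M N t x 0‖ ≤ c := fun x hx t ht =>
    (hrem x hx t ht 0 (mem_closedBall_self (by norm_num))).2
  refine
    { cont := fun q ⟨hx, ht, hy⟩ => (continuousAt_fixedPointMap hF (hY _ ht) (hlead _ ht)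
        (norm_pos_iff.1 hx.1) (hpert _ hx _ ht _ hy)).continuousWithinAt
      diff := fun t ht x hx y hy => differentiableAt_fixedPointMap hF (norm_pos_iff.1 hx.1)
        (hpert x hx t ht y hy)
      zero := fun x hx t ht => ?_
      lip := fun x hx t ht y hy y' hy' E hE hEM => norm_fixedPointMap_sub_le_half hF (hlead t ht)
        (hrem x hx t ht) (hβ t ht) (hγ t ht) hβM hγc hy hy' hE hEM }
  rw [fixedPointMap_zero (hlead t ht), norm_neg]
  exact (norm_mul_le_of_le (hc x hx t ht) (hγ t ht)).trans (by linarith)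

theorem exists_isContractive (hA : IsCompact A) (hΔ : IsOpen Δ) (hF : AnalyticOnNhd ℂ F Δ)
    (hY : ∀ t ∈ A, IsSolutionAt Δ F Y N t)
    (hlead : ∀ t ∈ A, leadCoeff F Y N (Fin.last n) t ≠ 0) :
    ∃ M : ℕ, 0 < M ∧ ∃ s : ℝ, 0 < s ∧ IsContractive M A s (fixedPointMap F Y M N) := by
  have hcont : ∀ i, ContinuousOn (leadCoeff F Y N i) A := fun i t ht =>
    ((hY t ht).continuousAt_leadCoeff hF i).continuousWithinAt
  obtain ⟨γ, hγ⟩ := hA.exists_bound_of_continuousOn ((hcont (Fin.last n)).inv₀ hlead)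
  obtain ⟨β, hβ⟩ := hA.exists_bound_of_continuousOn (continuousOn_finsetSum Finset.univ
    fun (i : Fin n) _ => ((hcont i.castSucc).div (hcont (Fin.last n)) hlead).norm)
  obtain ⟨M, hM⟩ := exists_nat_gt (max (N : ℝ) (4 * β))
  have hNM : N < M := by exact_mod_cast (le_max_left _ _).trans_lt hM
  obtain ⟨s, hs, hrem⟩ := exists_radius_norm_remainder_le hA hΔ hF hY hNM (a := 3)
    (c := 1 / (4 * (|γ| + 1))) (by positivity)
  refine ⟨M, by omega, s, hs, isContractive_fixedPointMap hF hY hlead (γ := |γ| + 1) hrem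
    (fun t ht => (le_abs_self _).trans (hβ t ht))
    (fun t ht => (hγ t ht).trans (by linarith [le_abs_self γ])) ((le_max_right _ _).trans_lt hM) ?_⟩
  field_simp
  rfl

theorem perturbation_smul {L m : ℕ} {x : ℂ} {y : Fin (n + 1) → ℂ} :
    perturbation Y L m t x (x • y) = perturbation Y L (m + 1) t x y := by
  rw [perturbation, perturbation, smul_smul, pow_succ]

theorem exists_norm_fixedPointMap_tail_sub_le (hA : IsCompact A) (hΔ : IsOpen Δ)
    (hF : AnalyticOnNhd ℂ F Δ) (hY : ∀ t ∈ A, IsSolutionAt Δ F Y N t)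
    (hlead : ∀ t ∈ A, leadCoeff F Y N (Fin.last n) t ≠ 0) (M k : ℕ) :
    ∃ R C : ℝ, 0 < R ∧ 0 ≤ C ∧ ∀ x ∈ puncturedDisc R, ∀ t ∈ A,
      ‖fixedPointMap F Y M N x t (x • tail Y (M + 1) (k + N) t x) -
        (x • tail Y (M + 1) (k + N) t x) (Fin.last n)‖ ≤ C * ‖x‖ ^ (k + 1) := by
  have hcont : ContinuousOn (leadCoeff F Y N (Fin.last n)) A := fun t ht =>
    ((hY t ht).continuousAt_leadCoeff hF _).continuousWithinAt
  obtain ⟨γ, hγ⟩ := hA.exists_bound_of_continuousOn (hcont.inv₀ hlead)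
  obtain ⟨R, C, hR, hC, hbound⟩ := exists_norm_comp_truncation_le hA hΔ hF hY (M + (k + N))
  refine ⟨R, C * |γ|, hR, by positivity, fun x hx t ht => ?_⟩
  have hx0 : 0 < ‖x‖ := hx.1
  have htrunc : ‖F (truncation Y (M + 1 + (k + N)) t x) / x ^ (M + N)‖ ≤ C * ‖x‖ ^ (k + 1) := by
    rw [norm_div, norm_pow, div_le_iff₀ (by positivity), add_right_comm M 1]
    exact (hbound x (mem_ball_zero_iff.2 hx.2) t ht).trans_eq (by ring)
  rw [fixedPointMap, perturbation_smul, perturbation_tail, sub_sub_cancel_left, norm_neg,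
    div_eq_mul_inv _ (leadCoeff ..), mul_right_comm]
  exact norm_mul_le_of_le htrunc ((hγ t ht).trans (le_abs_self γ))

end

theorem differentiableOn_iterate_delta {r η : ℝ} {α : ℕ → ℂ → ℂ}
    (hα : ∀ k, DifferentiableOn ℂ (α k) (puncturedDisc r)) (i k : ℕ) :
    DifferentiableOn ℂ ((delta η)^[i] α k) (puncturedDisc r) := by
  induction i generalizing k with
  | zero => exact hα k
  | succ i ih =>
    rw [Function.iterate_succ_apply']
    exact ((ih k).const_mul _).add (DifferentiableOn.mul (by fun_prop)
      ((ih k).deriv (isOpen_puncturedDisc r)))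

theorem continuousAt_jet {n : ℕ} {r η : ℝ} {α : ℕ → ℂ → ℂ}
    (hα : ∀ k, DifferentiableOn ℂ (α k) (puncturedDisc r)) {t : ℂ} (ht : t ∈ puncturedDisc r)
    (i : Fin (n + 1)) (k : ℕ) : ContinuousAt (jet n η α i k) t :=
  (differentiableOn_iterate_delta hα i k).continuousOn.continuousAt
    ((isOpen_puncturedDisc r).mem_nhds ht)

theorem exists_admissible_sum_mul_pow {A : Set ℂ} (hA : IsCompact A) {c : ℕ → ℂ → ℂ}
    (hc : ∀ j, ContinuousOn (c j) A) (L : ℕ) :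
    ∃ C : ℝ, 0 ≤ C ∧ ∀ ρ ≤ 1, Admissible A ρ (C * ρ)
      (fun x t => ∑ j ∈ Finset.range L, c j t * x ^ (j + 1)) := by
  choose β hβ using fun j => hA.exists_bound_of_continuousOn (hc j)
  refine ⟨∑ j ∈ Finset.range L, |β j|, Finset.sum_nonneg fun _ _ => abs_nonneg _, fun ρ hρ =>
    ⟨?_, fun t _ => by fun_prop, fun x hx t ht => ?_⟩⟩
  · exact continuousOn_finsetSum _ fun j _ =>
      ((hc j).comp continuousOn_snd fun p hp => hp.2).mul (by fun_prop)
  · rw [Finset.sum_mul]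
    refine norm_sum_le_of_le _ fun j _ => norm_mul_le_of_le ((hβ j t ht).trans (le_abs_self _)) ?_
    rw [norm_pow, pow_succ']
    exact (mul_le_of_le_one_right (norm_nonneg _)
      (pow_le_one₀ (norm_nonneg _) (hx.2.le.trans hρ))).trans hx.2.le

theorem hasDerivAt_dampedFlow_mul_pow {κ η : ℝ} {a : ℂ → ℂ} {x t : ℂ} {m : ℕ} {u : ℝ}
    (ha : DifferentiableAt ℂ a (Complex.exp (-(Complex.I * η * u)) * t)) :
    HasDerivAt (fun u => dampedFlow κ η (fun x t => a t * x ^ m) u x t)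
      (-dampedFlow κ η (fun x t => ((κ + m) * a t + Complex.I * η * t * deriv a t) * x ^ m) u x t)
      u := by
  have hu : HasDerivAt (fun u : ℝ => (u : ℂ)) 1 u := Complex.ofRealCLM.hasDerivAt
  have hdamp : HasDerivAt (fun u : ℝ => Complex.exp (-κ * u)) (Complex.exp (-κ * u) * (-κ * 1)) u :=
    (hu.const_mul (-κ : ℂ)).cexp
  have ht : HasDerivAt (fun u : ℝ => Complex.exp (-(Complex.I * η * u)) * t)
      (Complex.exp (-(Complex.I * η * u)) * (-(Complex.I * η * 1)) * t) u :=
    ((hu.const_mul (Complex.I * η)).neg).cexp.mul_const t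
  have hx : HasDerivAt (fun u : ℝ => Complex.exp (-u) * x) (Complex.exp (-u) * -1 * x) u :=
    hu.neg.cexp.mul_const x
  refine (hdamp.mul ((ha.hasDerivAt.comp u ht).mul (hx.pow m))).congr_deriv ?_
  simp only [dampedFlow, Function.comp_apply, Pi.mul_apply, Pi.pow_apply]
  rcases m with _ | m
  · simp only [pow_zero, Nat.cast_zero, add_zero, zero_mul, mul_one, mul_zero]
    ring
  · push_cast [Nat.add_sub_cancel]
    ring

/-- The terms of degree `M + 1, …, M + L` of `δ ^ i φ`, divided by `x ^ M`. -/
def shiftedTail (η : ℝ) (α : ℕ → ℂ → ℂ) (M L i : ℕ) (x t : ℂ) : ℂ :=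
  ∑ j ∈ Finset.range L, (delta η)^[i] α (M + 1 + j) t * x ^ (j + 1)

section

variable {A : Set ℂ} {r η : ℝ} {α : ℕ → ℂ → ℂ}

theorem shiftedTail_eq_smul_tail {n M L : ℕ} {x t : ℂ} :
    (fun i : Fin (n + 1) => shiftedTail η α M L i x t) = x • tail (jet n η α) (M + 1) L t x := by
  funext i
  simp only [shiftedTail, tail, jet, Pi.smul_apply, smul_eq_mul, Finset.mul_sum, pow_succ',
    mul_left_comm]

theorem flowInt_shiftedTail_succ (hA : IsCompact A) (hrot : RotInvariant A)
    (hAr : A ⊆ puncturedDisc r) (hα : ∀ k, DifferentiableOn ℂ (α k) (puncturedDisc r)) {M : ℕ}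
    (hM : 0 < M) (i L : ℕ) {x t : ℂ} (hx : x ∈ puncturedDisc 1) (ht : t ∈ A) :
    flowInt M η (shiftedTail η α M L (i + 1)) x t = shiftedTail η α M L i x t := by
  have hadm : ∀ i, ∃ C, Admissible A 1 C (shiftedTail η α M L i) := fun i =>
    have ⟨C, _, hC⟩ := exists_admissible_sum_mul_pow hA (fun j =>
      (differentiableOn_iterate_delta (η := η) hα i (M + 1 + j)).continuousOn.mono hAr) L
    ⟨C * 1, hC 1 le_rfl⟩
  obtain ⟨C, hC⟩ := hadm (i + 1)
  obtain ⟨C', hC'⟩ := hadm i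
  refine hC.flowInt_eq_of_hasDerivAt hrot (by exact_mod_cast hM) hC' hx ht fun u => ?_
  have hterm : ∀ j ∈ Finset.range L, HasDerivAt _ _ u := fun j _ =>
    hasDerivAt_dampedFlow_mul_pow (κ := M) (x := x) (m := j + 1)
      ((differentiableOn_iterate_delta (η := η) hα i (M + 1 + j)).differentiableAt
        ((isOpen_puncturedDisc r).mem_nhds (hAr (hrot.exp_mul_mem ht η u))))
  have hsum : (fun u => dampedFlow M η (shiftedTail η α M L i) u x t) = fun u =>
      ∑ j ∈ Finset.range L,
        dampedFlow M η (fun x t => (delta η)^[i] α (M + 1 + j) t * x ^ (j + 1)) u x t := by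
    funext u
    simp only [dampedFlow, shiftedTail, Finset.mul_sum]
  rw [hsum]
  refine (HasDerivAt.fun_sum hterm).congr_deriv ?_
  simp only [dampedFlow, shiftedTail, Finset.mul_sum, Finset.sum_neg_distrib,
    Function.iterate_succ_apply']
  refine congrArg Neg.neg (Finset.sum_congr rfl fun j _ => ?_)
  simp only [delta]
  push_cast
  ring

theorem exists_norm_tail_coeff_le {n N : ℕ} {Δ : Set (ℂ × (Fin (n + 1) → ℂ))}
    {F : ℂ × (Fin (n + 1) → ℂ) → ℂ} (hΔ : IsOpen Δ) (hF : AnalyticOnNhd ℂ F Δ)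
    (hA : IsCompact A) (hrot : RotInvariant A) (hAr : A ⊆ puncturedDisc r)
    (hα : ∀ k, DifferentiableOn ℂ (α k) (puncturedDisc r))
    (hY : ∀ t ∈ A, IsSolutionAt Δ F (jet n η α) N t)
    (hlead : ∀ t ∈ A, leadCoeff F (jet n η α) N (Fin.last n) t ≠ 0) :
    ∃ (M : ℕ) (s : ℝ), 0 < s ∧ ∀ t ∈ A, ∀ k, ‖α (M + 1 + k) t‖ ≤ (2 / s) ^ (k + 1) := by
  obtain ⟨M, hM, s, hs, hΨ⟩ := exists_isContractive hA hΔ hF hY hlead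
  refine ⟨M, s, hs, fun t ht k => ?_⟩
  set L := k + 1 + N
  obtain ⟨R, C, hR, hC, happrox⟩ :=
    exists_norm_fixedPointMap_tail_sub_le hA hΔ hF hY hlead M (k + 1)
  obtain ⟨C', hC', hadm⟩ := exists_admissible_sum_mul_pow hA (fun j =>
    (differentiableOn_iterate_delta (η := η) hα n (M + 1 + j)).continuousOn.mono hAr) L
  set ρ := min R (1 / (C' + 1))
  have hρ0 : 0 < ρ := by positivity
  have hρC : ρ * (C' + 1) ≤ 1 := (le_div_iff₀ (by positivity)).1 (min_le_right _ _)
  have hρ1 : ρ ≤ 1 := by nlinarith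
  have hderiv := hΨ.norm_iteratedDeriv_le (η := η) hrot (by exact_mod_cast hM) hs hρ0 hC
    (w := shiftedTail η α M L)
    ((hadm ρ hρ1).of_bound fun x hx t ht => ((hadm ρ hρ1).bound x hx t ht).trans (by linarith))
    (fun i _ x hx t ht =>
      flowInt_shiftedTail_succ hA hrot hAr hα hM i L (puncturedDisc_mono hρ1 hx) ht)
    (fun x hx t ht => by
      have hlast := congrFun (shiftedTail_eq_smul_tail (n := n) (η := η) (α := α) (M := M) (L := L)
        (x := x) (t := t)) (Fin.last n)
      rw [Fin.val_last] at hlast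
      rw [hlast, shiftedTail_eq_smul_tail]
      exact happrox x (puncturedDisc_mono (min_le_left _ _) hx) t ht)
    ht (by unfold shiftedTail; fun_prop)
  simp only [shiftedTail, Function.iterate_zero_apply] at hderiv
  rw [iteratedDeriv_sum_pow_zero _ (by omega), norm_mul, Complex.norm_natCast] at hderiv
  exact le_of_mul_le_mul_left hderiv (by positivity)

end

theorem exists_norm_le_mul_pow {X E : Type*} [TopologicalSpace X] [SeminormedAddCommGroup E]
    {A : Set X} (hA : IsCompact A) {c : ℕ → X → E} (hc : ∀ k, ContinuousOn (c k) A) {m : ℕ}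
    {D K : ℝ} (hD : 0 ≤ D) (hK : 0 < K) (h : ∀ t ∈ A, ∀ k, ‖c (m + k) t‖ ≤ D * K ^ k) :
    ∃ C, ∀ t ∈ A, ∀ k, ‖c k t‖ ≤ C * K ^ k := by
  choose β hβ using fun k => hA.exists_bound_of_continuousOn (hc k)
  have hsum : ∀ k, 0 ≤ |β k| / K ^ k := fun k => by positivity
  refine ⟨D / K ^ m + ∑ k ∈ Finset.range m, |β k| / K ^ k, fun t ht k => ?_⟩
  rw [← div_le_iff₀ (by positivity)]
  rcases lt_or_ge k m with hk | hk
  · calc ‖c k t‖ / K ^ k ≤ |β k| / K ^ k := by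
          gcongr
          exact (hβ k t ht).trans (le_abs_self _)
      _ ≤ ∑ k ∈ Finset.range m, |β k| / K ^ k :=
          Finset.single_le_sum (fun k _ => hsum k) (Finset.mem_range.2 hk)
      _ ≤ _ := le_add_of_nonneg_left (by positivity)
  · obtain ⟨j, rfl⟩ := Nat.exists_eq_add_of_le hk
    calc ‖c (m + j) t‖ / K ^ (m + j) ≤ D * K ^ j / K ^ (m + j) := by
          gcongr
          exact h t ht j
      _ = D / K ^ m := by
          rw [pow_add]
          field_simp
      _ ≤ _ := le_add_of_nonneg_right (Finset.sum_nonneg fun k _ => hsum k)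

theorem exists_norm_coeff_le {n N : ℕ} {Δ : Set (ℂ × (Fin (n + 1) → ℂ))}
    {F : ℂ × (Fin (n + 1) → ℂ) → ℂ} (hΔ : IsOpen Δ) (hF : AnalyticOnNhd ℂ F Δ) {A : Set ℂ}
    (hA : IsCompact A) (hrot : RotInvariant A) {r η : ℝ} (hAr : A ⊆ puncturedDisc r)
    {α : ℕ → ℂ → ℂ} (hα : ∀ k, DifferentiableOn ℂ (α k) (puncturedDisc r))
    (hY : ∀ t ∈ A, IsSolutionAt Δ F (jet n η α) N t)
    (hlead : ∀ t ∈ A, leadCoeff F (jet n η α) N (Fin.last n) t ≠ 0) :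
    ∃ C K : ℝ, 0 < K ∧ ∀ t ∈ A, ∀ k, ‖α k t‖ ≤ C * K ^ k := by
  obtain ⟨M, s, hs, htail⟩ := exists_norm_tail_coeff_le hΔ hF hA hrot hAr hα hY hlead
  have hK : 0 < 2 / s := by positivity
  obtain ⟨C, hbound⟩ := exists_norm_le_mul_pow hA (fun k => (hα k).continuousOn.mono hAr)
    hK.le hK fun t ht k => (htail t ht k).trans_eq (pow_succ' _ _)
  exact ⟨C, 2 / s, hK, hbound⟩

theorem tendstoUniformlyOn_sum_mul_pow {X 𝕜 : Type*} [NormedRing 𝕜] [NormOneClass 𝕜]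
    [CompleteSpace 𝕜] {a : ℕ → X → 𝕜} {z : X → 𝕜} {S : Set X} {C K : ℝ} (hK : 0 < K)
    (ha : ∀ x ∈ S, ∀ k, ‖a k x‖ ≤ C * K ^ k) (hz : ∀ x ∈ S, ‖z x‖ ≤ 1 / (2 * K)) :
    TendstoUniformlyOn (fun L x => ∑ k ∈ Finset.range L, a k x * z x ^ k)
      (fun x => ∑' k, a k x * z x ^ k) atTop S := by
  have hgeom : Summable fun k : ℕ => C * (1 / 2 : ℝ) ^ k :=
    summable_geometric_two.mul_left C
  refine tendstoUniformlyOn_tsum_nat hgeom fun k x hx => ?_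
  calc ‖a k x * z x ^ k‖ ≤ C * K ^ k * (1 / (2 * K)) ^ k :=
        norm_mul_le_of_le (ha x hx k) ((norm_pow_le _ _).trans
          (pow_le_pow_left₀ (norm_nonneg _) (hz x hx) k))
    _ = C * (1 / 2) ^ k := by
        rw [mul_assoc, ← mul_pow]
        congr 2
        field_simp

theorem isOpen_polydisc {n : ℕ} (ρ : ℝ) (ε : Fin (n + 1) → ℝ≥0∞) : IsOpen (polydisc ρ ε) := by
  simp only [polydisc, ofPred_and, ofPred_forall]
  exact (isOpen_lt (by fun_prop) continuous_const).inter
    (isOpen_iInter_of_finite fun j => isOpen_lt (by fun_prop) continuous_const)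

theorem exists_puncturedDisc_of_eventually {P : ℂ → Prop} (h : ∀ᶠ t in 𝓝[≠] (0 : ℂ), P t) :
    ∃ r > 0, ∀ t ∈ puncturedDisc r, P t := by
  obtain ⟨r, hr, hsub⟩ := (nhdsWithin_hasBasis Metric.nhds_basis_ball _).mem_iff.1 h
  exact ⟨r, hr, fun t ht => hsub ⟨by simpa using ht.2, norm_pos_iff.1 ht.1⟩⟩

theorem rotInvariant_closedBall_sdiff_ball (a c : ℝ) :
    RotInvariant (closedBall 0 c \ ball 0 a) := by
  intro t ht z hz
  simpa [hz] using ht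

theorem branchLog_mul_exp {R θ : ℝ} (hR : 0 < R) (hθ : 0 < θ) (hθ' : θ < 2 * Real.pi) (m : ℤ) :
    branchLog m (R * Complex.exp (θ * Complex.I)) =
      Real.log R + (θ + 2 * m * Real.pi) * Complex.I := by
  have hneg : -((R : ℂ) * Complex.exp (θ * Complex.I)) =
      R * Complex.exp ((θ - Real.pi : ℝ) * Complex.I) := by
    push_cast
    rw [sub_mul, Complex.exp_sub, Complex.exp_pi_mul_I]
    ring
  have him : ((θ - Real.pi : ℝ) * Complex.I).im = θ - Real.pi := by simp
  rw [branchLog, hneg, Complex.log_ofReal_mul hR (Complex.exp_ne_zero _),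
    Complex.log_exp (by linarith) (by linarith)]
  push_cast
  ring

theorem norm_branchPow_mul_exp {R θ : ℝ} (hR : 0 < R) (hθ : 0 < θ) (hθ' : θ < 2 * Real.pi) (m : ℤ)
    (η : ℝ) : ‖branchPow m η (R * Complex.exp (θ * Complex.I))‖ =
      Real.exp (-(η * (θ + 2 * m * Real.pi))) := by
  rw [branchPow, branchLog_mul_exp hR hθ hθ', Complex.norm_exp]
  congr 1
  simp [mul_comm, mul_left_comm]

theorem exists_lt_mul_intCast {𝕜 : Type*} [Field 𝕜] [LinearOrder 𝕜] [IsStrictOrderedRing 𝕜]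
    [Archimedean 𝕜] {η : 𝕜} (hη : η ≠ 0) (X : 𝕜) : ∃ m : ℤ, X < η * m := by
  rcases lt_or_gt_of_ne hη with h | h
  · obtain ⟨m, hm⟩ := exists_int_lt (X / η)
    exact ⟨m, by rwa [lt_div_iff_of_neg' h] at hm⟩
  · obtain ⟨m, hm⟩ := exists_int_gt (X / η)
    exact ⟨m, by rwa [div_lt_iff₀' h] at hm⟩

/- On a sector `θ₁ < arg x < θ₂` the modulus `e^{-η arg x}` of `x ^ (iη)` is bounded above and
below; passing to another branch multiplies it by `e^{-2πηm}`, which is as small as desired. -/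
theorem exists_branchPow_mem_annulus {η r : ℝ} (hη : η ≠ 0) (hr : 0 < r) :
    ∃ (m : ℤ) (a c : ℝ), 0 < a ∧ c < r ∧
      ∀ R, ∀ x ∈ openSector R 1 2, branchPow m η x ∈ closedBall 0 c \ ball 0 a := by
  obtain ⟨m, hm⟩ := exists_lt_mul_intCast hη (|Real.log r| + 2 * |η|)
  have hpi : 3 < Real.pi := Real.pi_gt_three
  refine ⟨m, Real.exp (-(2 * |η|) - 2 * Real.pi * (η * m)),
    Real.exp (2 * |η| - 2 * Real.pi * (η * m)), Real.exp_pos _, ?_, ?_⟩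
  · rw [← Real.lt_log_iff_exp_lt hr]
    have hηm : 0 ≤ η * m := (by positivity : (0 : ℝ) ≤ |Real.log r| + 2 * |η|).trans hm.le
    nlinarith [neg_abs_le (Real.log r)]
  · rintro R x ⟨ρ, θ, hρ, -, h1, h2, rfl⟩
    rw [Set.mem_sdiff, mem_closedBall_zero_iff, mem_ball_zero_iff, not_lt,
      norm_branchPow_mul_exp hρ (by linarith) (by linarith), Real.exp_le_exp, Real.exp_le_exp]
    have hηθ : |η * θ| ≤ 2 * |η| := by
      rw [abs_mul, abs_of_pos (by linarith : 0 < θ), mul_comm]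
      exact mul_le_mul_of_nonneg_right h2.le (abs_nonneg _)
    have hηθ' := abs_le.1 hηθ
    constructor <;> linarith

theorem openSector_subset_compl_nonnegRay {R θ₁ θ₂ : ℝ} (h₁ : 0 ≤ θ₁) (h₂ : θ₂ ≤ Real.pi) :
    openSector R θ₁ θ₂ ⊆ nonnegRayᶜ := by
  rintro x ⟨ρ, θ, hρ, -, hθ₁, hθ₂, rfl⟩ ⟨-, him⟩
  rw [Complex.im_ofReal_mul, Complex.exp_ofReal_mul_I_im] at him
  exact (mul_pos hρ (Real.sin_pos_of_pos_of_lt_pi (by linarith) (by linarith))).ne' him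

theorem norm_lt_of_mem_openSector {R θ₁ θ₂ : ℝ} {x : ℂ} (hx : x ∈ openSector R θ₁ θ₂) :
    ‖x‖ < R := by
  obtain ⟨ρ, θ, hρ, h, -, -, rfl⟩ := hx
  rwa [norm_mul, Complex.norm_exp_ofReal_mul_I, mul_one, Complex.norm_of_nonneg hρ.le]

end Exotic

end

theorem theorem1_general {n : ℕ} {Δ : Set (ℂ × (Fin (n + 1) → ℂ))} (hΔ : IsOpen Δ)
    {F : ℂ × (Fin (n + 1) → ℂ) → ℂ} (hF : AnalyticOnNhd ℂ F Δ)
    {η : ℝ} (hη : η ≠ 0) {r : ℝ} (hr : 0 < r)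
    {α : ℕ → ℂ → ℂ} (hα : ∀ k, DifferentiableOn ℂ (α k) (Exotic.puncturedDisc r))
    (hsol : Exotic.IsFormalSolution Δ F η α) {N : ℕ}
    (hvan : ∀ i, ∀ᶠ t in 𝓝[≠] (0 : ℂ),
      ∀ k < N, Exotic.substCoeff (Exotic.partialY F i) (Exotic.jet n η α) k t = 0)
    (hlead : ∀ᶠ t in 𝓝[≠] (0 : ℂ),
      Exotic.substCoeff (Exotic.partialY F (Fin.last n)) (Exotic.jet n η α) N t ≠ 0) :
    ∃ R θ₁ θ₂ : ℝ, 0 < R ∧ θ₁ < θ₂ ∧ Exotic.openSector R θ₁ θ₂ ⊆ Exotic.nonnegRayᶜ ∧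
      ∃ m : ℤ,
        (∀ x ∈ Exotic.openSector R θ₁ θ₂, Exotic.branchPow m η x ∈ Exotic.puncturedDisc r) ∧
        ∃ f : ℂ → ℂ, TendstoUniformlyOn
          (fun (K : ℕ) (x : ℂ) => ∑ k ∈ Finset.range K, α k (Exotic.branchPow m η x) * x ^ k)
          f atTop (Exotic.openSector R θ₁ θ₂) := by
  obtain ⟨r₁, hr₁, hgood⟩ := Exotic.exists_puncturedDisc_of_eventually
    ((hsol.and (eventually_all.2 hvan)).and hlead)
  obtain ⟨m, a, c, ha, hc, hsector⟩ := Exotic.exists_branchPow_mem_annulus hη (lt_min hr hr₁)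
  set A : Set ℂ := Metric.closedBall 0 c \ Metric.ball 0 a
  have hA : ∀ t ∈ A, 0 < ‖t‖ ∧ ‖t‖ < min r r₁ := fun t ht =>
    ⟨ha.trans_le (by simpa using ht.2), (mem_closedBall_zero_iff.1 ht.1).trans_lt hc⟩
  have hAr : A ⊆ Exotic.puncturedDisc r := fun t ht =>
    Exotic.puncturedDisc_mono (min_le_left _ _) (hA t ht)
  have hAgood := fun t (ht : t ∈ A) =>
    hgood t (Exotic.puncturedDisc_mono (min_le_right _ _) (hA t ht))
  obtain ⟨C, K, hK, hbound⟩ := Exotic.exists_norm_coeff_le hΔ hF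
    ((isCompact_closedBall _ _).diff Metric.isOpen_ball)
    (Exotic.rotInvariant_closedBall_sdiff_ball a c) hAr hα
    (fun t ht => ⟨Exotic.continuousAt_jet hα (hAr ht), (hAgood t ht).1.1.1, (hAgood t ht).1.1.2,
      (hAgood t ht).1.2⟩) fun t ht => (hAgood t ht).2
  refine ⟨1 / (2 * K), 1, 2, by positivity, one_lt_two,
    Exotic.openSector_subset_compl_nonnegRay zero_le_one (by linarith [Real.pi_gt_three]), m,
    fun x hx => hAr (hsector _ x hx), _,
    Exotic.tendstoUniformlyOn_sum_mul_pow hK (fun x hx => hbound _ (hsector _ x hx))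
      fun x hx => (Exotic.norm_lt_of_mem_openSector hx).le⟩

theorem theorem1 {n : ℕ} (ρ : ℝ) (hρ : 0 < ρ)
    (ε : Fin (n + 1) → ℝ≥0∞) (hε : ∀ j, 0 < ε j)
    (F : ℂ × (Fin (n + 1) → ℂ) → ℂ) (hF : AnalyticOnNhd ℂ F (Exotic.polydisc ρ ε))
    (η : ℝ) (hη : η ≠ 0) (r : ℝ) (hr : 0 < r)
    (α : ℕ → ℂ → ℂ) (hα : Exotic.IsExoticSeries r α)
    (hsol : Exotic.IsFormalSolution (Exotic.polydisc ρ ε) F η α)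
    (N : ℕ) (B : Fin (n + 1) → ℂ → ℂ) (hB : ∀ i, MeromorphicAt (B i) 0)
    (hform : ∀ i, ∀ᶠ t in 𝓝[≠] (0 : ℂ),
      (∀ k < N, Exotic.substCoeff (Exotic.partialY F i) (Exotic.jet n η α) k t = 0) ∧
        Exotic.substCoeff (Exotic.partialY F i) (Exotic.jet n η α) N t = B i t)
    (hBn : ¬ ∀ᶠ t in 𝓝[≠] (0 : ℂ), B (Fin.last n) t = 0)
    (hord : ∀ i, meromorphicOrderAt (B (Fin.last n)) 0 ≤ meromorphicOrderAt (B i) 0) :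
    ∃ R θ₁ θ₂ : ℝ, 0 < R ∧ θ₁ < θ₂ ∧ Exotic.openSector R θ₁ θ₂ ⊆ Exotic.nonnegRayᶜ ∧
      ∃ m : ℤ,
        (∀ x ∈ Exotic.openSector R θ₁ θ₂, Exotic.branchPow m η x ∈ Exotic.puncturedDisc r) ∧
        ∃ f : ℂ → ℂ, TendstoUniformlyOn
          (fun (K : ℕ) (x : ℂ) => ∑ k ∈ Finset.range K, α k (Exotic.branchPow m η x) * x ^ k)
          f atTop (Exotic.openSector R θ₁ θ₂) := by
  have hne := (hB (Fin.last n)).eventually_eq_zero_or_eventually_ne_zero.resolve_left hBn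
  refine theorem1_general (Exotic.isOpen_polydisc ρ ε) hF hη hr (fun k => (hα k).2) hsol
    (fun i => (hform i).mono fun _ h => h.1) ?_
  filter_upwards [hform (Fin.last n), hne] with t h hB using h.2 ▸ hB
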